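/- Let $d\ge 2$ and $K\ge 2$ be integers and let $\alpha>\beta>0$ satisfy $(\sqrt\alpha-\sqrt\beta)^2>K^{d-1}(d-1)!$. For $n$ divisible by $K$ let $$\mathcal H=\{H\in\{0,1\}^{n\times K}:\ H\mathbf 1_K=\mathbf 1_n,\ H^\top\mathbf 1_n=(n/K)\,\mathbf 1_K\},$$ let $\Pi_K$ be the set of $K\times K$ permutation matrices, and for $M\in\mathbb R^{n\times K}$ let $\mathcal T(M)=\arg\min\{\|H-M\|_F: H\in\mathcal H\}$. Let $p=\alpha\log n/n^{d-1}$, $q=\beta\log n/n^{d-1}$, and let $\mathcal A$ be the adjacency tensor of the symmetric $d$-uniform hypergraph stochastic block model with planted partition $H^*\in\mathcal H$: $\mathcal A$ is a symmetric random tensor of order $d$ and dimension $n$, its entries with a repeated index are $0$, and the entries $\mathcal A_{i_1,\dots,i_d}$ with $i_1<\dots<i_d$ are independent Bernoulli variables, with parameter $p$ if $i_1,\dots,i_d$ lie in the same community of $H^*$ and $q$ otherwise. Write $$\big(\mathcal A[H^{\otimes(d-1)}]\big)_{ik}=\sum_{i_2,\dots,i_d=1}^n\mathcal A_{i,i_2,\dots,i_d}H_{i_2k}\cdots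 H_{i_dk}.$$ Then there is a constant $C>0$ depending only on $\alpha,\beta,d,K$ such that the following holds for every constant $\gamma>0$ with $$\frac{(\sqrt\alpha-\sqrt\beta)^2}{K^{d-1}(d-1)!}-\frac{\gamma\log(\alpha/\beta)}{2(d-1)!}-1>0.$$ There are $c>0$ and $N$, depending only on $\alpha,\beta,d,K,\gamma$, such that for all $n\ge N$ with $K\mid n$ and $n>\exp(16C^2/\gamma^2)$, and every $H^*\in\mathcal H$, with probability at least $1-n^{-c}$ both of the following hold. (i) $\gamma$ is a separation constant: $\big(\mathcal A[(H^*)^{\otimes(d-1)}]\big)_{ik}-\big(\mathcal A[(H^*)^{\otimes(d-1)}]\big)_{i\ell}\ge\gamma\log n$ whenever $H^*_{ik}=1$ and $\ell\neq k$. (ii) For all $$\varepsilon\in\left(0,\ \min\left\{\frac1{\sqrt{K(d-1)}},\ \frac{\gamma K^{d-3/2}}{16(d-1)(\alpha-\beta)}\right\}\right)$$ the number $$\kappa=4\max\left\{\frac{4(d-1)\varepsilon(\alpha-\beta)}{\gamma K^{d-3/2}},\ \frac{C}{\gamma\sqrt{\log n}}\right\}$$ lies in $(0,1)$, and for all $H\in\mathcal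 H$ and $Q\in\Pi_K$ with $\|H-H^*Q\|_F\le\varepsilon\sqrt n$, every $V\in\mathcal T(\mathcal A[H^{\otimes(d-1)}])$ satisfies $$\|V-H^*Q\|_F\le\kappa\,\|H-H^*Q\|_F .$$ -/

import Mathlib

open MeasureTheory ProbabilityTheory
open scoped Nat

universe u

/-! Norms of matrices are Frobenius norms throughout. -/
attribute [local instance] Matrix.frobeniusNormedAddCommGroup

namespace HSBM

/-- Real tensors of order `d` and dimension `n`. -/
abbrev Tensor (d n : ℕ) : Type := (Fin d → Fin n) → ℝ

/-- The feasible set: `0`-`1` matrices of size `n × K` all of whose rows sum to `1` and all of whose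
columns sum to `m = n / K` (a division of real numbers, so the set is empty when `K ∤ n`). -/
def feasible (n K : ℕ) : Set (Matrix (Fin n) (Fin K) ℝ) :=
  {H | (∀ i k, H i k = 0 ∨ H i k = 1) ∧ (∀ i, ∑ k, H i k = 1) ∧
    (∀ k, ∑ i, H i k = (n : ℝ) / (K : ℝ))}

/-- The projection onto the feasible set: all feasible matrices at least Frobenius distance
from `M`. -/
def proj {n K : ℕ} (M : Matrix (Fin n) (Fin K) ℝ) : Set (Matrix (Fin n) (Fin K) ℝ) :=
  {V | V ∈ feasible n K ∧ ∀ H ∈ feasible n K, ‖V - M‖ ≤ ‖H - M‖}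

/-- The multilinear operation `A[H^{⊗(d-1)}]`: its `(i, k)` entry is the inner product of `A` with
`e_i ⊗ (H_k)^{⊗(d-1)}`, where `H_k` is the `k`-th column of `H`, that is, the sum over
`i₂, …, i_d` of `A_{i, i₂, …, i_d} H_{i₂ k} ⋯ H_{i_d k}`. -/
def tensorApply {d n K : ℕ} (A : Tensor d n) (H : Matrix (Fin n) (Fin K) ℝ) :
    Matrix (Fin n) (Fin K) ℝ :=
  Matrix.of fun i k => ∑ j : Fin d → Fin n,
    A j * ∏ t : Fin d, if (t : ℕ) = 0 then (if j t = i then 1 else 0) else H (j t) k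

open Classical in
/-- The random tensor `A` on the probability space `(Ω, μ)` is the adjacency tensor of a random
hypergraph generated by the symmetric `d`-uniform hypergraph stochastic block model with `n` nodes,
`K` communities, hyperedge probabilities `p` (inside a community) and `q` (otherwise) and planted
partition `Hs`. The sum of `∏ t, Hs (e t) k` over `k` is the sum of the entries of the Hadamard
product of the rows `e 0, …, e (d - 1)` of `Hs`. -/
structure IsHSBM {n d K : ℕ} {Ω : Type u} [MeasurableSpace Ω] (μ : Measure Ω)
    (p q : unitInterval) (Hs : Matrix (Fin n) (Fin K) ℝ) (A : Ω → Tensor d n) : Prop where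
  measurable : Measurable A
  symmetric : ∀ (ω : Ω) (σ : Equiv.Perm (Fin d)) (i : Fin d → Fin n), A ω (i ∘ σ) = A ω i
  diagonal : ∀ (ω : Ω) (i : Fin d → Fin n), ¬ Function.Injective i → A ω i = 0
  indep : iIndepFun (fun (e : Fin d ↪o Fin n) (ω : Ω) => A ω e) μ
  law : ∀ e : Fin d ↪o Fin n, μ.map (fun ω => A ω e) =
    bernoulliMeasure (1 : ℝ) 0 (if ∑ k, ∏ t, Hs (e t) k = 1 then p else q)

/-- The strict upper bound on the radius `ε`. -/
noncomputable def radius (d K : ℕ) (α β γ : ℝ) : ℝ :=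
  min (1 / √((K : ℝ) * ((d : ℝ) - 1)))
    (γ * (K : ℝ) ^ ((d : ℝ) - 3 / 2) / (16 * ((d : ℝ) - 1) * (α - β)))

/-- The contraction factor `κ`. -/
noncomputable def contractionFactor (n d K : ℕ) (α β γ C ε : ℝ) : ℝ :=
  4 * max (4 * ((d : ℝ) - 1) * ε * (α - β) / (γ * (K : ℝ) ^ ((d : ℝ) - 3 / 2)))
    (C / (γ * √(Real.log n)))

end HSBM

/-! Write $r=d-1$, let $g$ be the planted labels and let $h$ be labels differing from $g$ at $s$
vertices, so that the squared Frobenius distance of the label matrices is $2s$. If the rows of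
$\mathcal A[(H^*)^{\otimes r}]$ are separated by $\gamma\log n$, comparing assignment scores gives
$\gamma\log n\,\|V-H^*\|\le 2\|\mathcal A[H^{\otimes r}]-\mathcal A[(H^*)^{\otimes r}]\|$
(`separation_mul_norm_proj_sub_le`). It remains to prove separation and a Lipschitz bound for the
tensor power.

Separation (`IsHSBM.measure_separation_le_rpow`) is a Chernoff bound. A hyperedge within one
community contributes only to the planted entry, and any other hyperedge only to the competing
entry. Tilting by $\sqrt{\alpha/\beta}$ produces $(\sqrt\alpha-\sqrt\beta)^2$, and the hypothesis on
$\gamma$ makes each failure probability at most $n^{-1-\delta/2}$ for large $n$, which survives a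
union over the $nK$ entries.

The Lipschitz bound splits into mean and noise. Since communities are balanced, the mean changes by
a term quadratic in the distance, which becomes the $\varepsilon$ term of $\kappa$, and a negligible
linear term (`abs_tensorApply_meanTensor_sub_le`). The noise must be controlled simultaneously for
all $h$ (`IsHSBM.measure_noise_gt_le`). Fixing the position of $i$ in the increasing order of a
hyperedge gives disjoint, hence independent, blocks. Each block sum has variance at most
$\nu=r\alpha s\log n/n$ and a Bennett tail. Degree bounds allow truncation at $L\asymp\log n$, and
the truncated square then has an exponential moment of order $\log(1+L/\nu)/(16L)$
(`mgf_truncated_sq_le`). As $\log(1+L/\nu)\ge 1+\log(n/s)$, the resulting tail beats the number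
$\exp(s\log(n/s)+Ks)$ of labellings at distance $s$. The sum of squared noises is thus $O(s\log n)$
uniformly; divided by the separation, it becomes the $C/(\gamma\sqrt{\log n})$ term. -/

namespace HSBM

/-! ### Label matrices and their Frobenius distances. -/

/-- The `0`-`1` matrix whose `i`-th row is the indicator of the label `g i`. -/
def labelMatrix {n K : ℕ} (g : Fin n → Fin K) : Matrix (Fin n) (Fin K) ℝ :=
  Matrix.of fun i k => if g i = k then 1 else 0

@[simp]
lemma labelMatrix_apply {n K : ℕ} (g : Fin n → Fin K) (i : Fin n) (k : Fin K) :
    labelMatrix g i k = if g i = k then 1 else 0 := rfl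

lemma frobenius_norm_sq {n K : ℕ} (M : Matrix (Fin n) (Fin K) ℝ) :
    ‖M‖ ^ 2 = ∑ i, ∑ k, M i k ^ 2 := by
  rw [Matrix.frobenius_norm_def, ← Real.sqrt_eq_rpow, Real.sq_sqrt (by positivity)]
  simp

lemma exists_labelMatrix {n K : ℕ} {H : Matrix (Fin n) (Fin K) ℝ} (hH : H ∈ feasible n K) :
    ∃ g : Fin n → Fin K, H = labelMatrix g := by
  obtain ⟨h01, hrow, -⟩ := hH
  have key : ∀ i, ∃ k, H i k = 1 ∧ ∀ l, l ≠ k → H i l = 0 := by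
    intro i
    have h1 : ∃ k, H i k = 1 := by
      by_contra! hne
      have : ∑ k, H i k = 0 := Finset.sum_eq_zero fun k _ => (h01 i k).resolve_right (hne k)
      rw [hrow] at this
      exact one_ne_zero this
    obtain ⟨k, hk⟩ := h1
    refine ⟨k, hk, fun l hl => (h01 i l).resolve_right fun h => ?_⟩
    have h2 : ∑ x ∈ ({k, l} : Finset (Fin K)), H i x ≤ ∑ x, H i x :=
      Finset.sum_le_sum_of_subset_of_nonneg (Finset.subset_univ _) fun x _ _ => by
        rcases h01 i x with h | h <;> simp [h]
    rw [Finset.sum_pair hl.symm, hk, h, hrow] at h2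
    norm_num at h2
  choose g hg hg' using key
  refine ⟨g, ?_⟩
  ext i k
  rw [labelMatrix_apply]
  split_ifs with h
  · rw [← h, hg]
  · exact hg' i k (Ne.symm h)

lemma card_label {n K : ℕ} {g : Fin n → Fin K} (hg : labelMatrix g ∈ feasible n K) (k : Fin K) :
    ((Finset.univ.filter fun i => g i = k).card : ℝ) = (n : ℝ) / K := by
  rw [← hg.2.2 k]
  simp

lemma labelMatrix_mem_feasible {n K : ℕ} {g : Fin n → Fin K}
    (hg : ∀ k, ((Finset.univ.filter fun i => g i = k).card : ℝ) = (n : ℝ) / K) :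
    labelMatrix g ∈ feasible n K := by
  refine ⟨fun i k => ?_, fun i => by simp, fun k => by rw [← hg k]; simp⟩
  rw [labelMatrix_apply]
  split_ifs <;> simp

/-- Permuting columns is relabelling, so every $H^*Q$ is handled as another planted labelling. -/
lemma labelMatrix_mul_permMatrix {n K : ℕ} (g : Fin n → Fin K) (σ : Equiv.Perm (Fin K)) :
    labelMatrix g * σ.permMatrix ℝ = labelMatrix (σ ∘ g) := by
  ext i k
  rw [Matrix.mul_apply, Finset.sum_eq_single (g i)]
  · simp [Equiv.Perm.permMatrix, PEquiv.toMatrix_apply, eq_comm]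
  · intro l _ hl
    simp [hl.symm]
  · simp

lemma labelMatrix_perm_mem_feasible {n K : ℕ} {g : Fin n → Fin K}
    (hg : labelMatrix g ∈ feasible n K) (σ : Equiv.Perm (Fin K)) :
    labelMatrix (σ ∘ g) ∈ feasible n K := by
  refine labelMatrix_mem_feasible fun k => ?_
  rw [← card_label hg (σ.symm k)]
  simp [Equiv.eq_symm_apply]

lemma frobenius_norm_sq_labelMatrix_sub {n K : ℕ} (g h : Fin n → Fin K) :
    ‖labelMatrix g - labelMatrix h‖ ^ 2 = 2 * ((Finset.univ.filter fun i => g i ≠ h i).card : ℝ) := by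
  rw [frobenius_norm_sq, Finset.card_filter, Nat.cast_sum, Finset.mul_sum]
  refine Finset.sum_congr rfl fun i _ => ?_
  simp only [Matrix.sub_apply, labelMatrix_apply]
  by_cases hi : g i = h i
  · simp [hi]
  · have : ∀ k, ((if g i = k then (1 : ℝ) else 0) - if h i = k then 1 else 0) ^ 2
        = (if g i = k then 1 else 0) + if h i = k then 1 else 0 := by
      intro k
      by_cases h1 : g i = k
      · have : h i ≠ k := fun h2 => hi (h1.trans h2.symm)
        simp [h1, this]
      · by_cases h2 : h i = k <;> simp [h1, h2]
    simp only [this, Finset.sum_add_distrib]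
    simp [hi]
    norm_num

/-- Only the score $\sum_i M_{i,g(i)}$ depends on $g$: projecting is maximising an assignment score.
-/
lemma frobenius_norm_sq_labelMatrix_sub_matrix {n K : ℕ} (g : Fin n → Fin K)
    (M : Matrix (Fin n) (Fin K) ℝ) :
    ‖labelMatrix g - M‖ ^ 2 = n - 2 * ∑ i, M i (g i) + ‖M‖ ^ 2 := by
  rw [frobenius_norm_sq, frobenius_norm_sq, Finset.mul_sum]
  have : (n : ℝ) = ∑ i : Fin n, (1 : ℝ) := by simp
  rw [this, ← Finset.sum_sub_distrib, ← Finset.sum_add_distrib]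
  refine Finset.sum_congr rfl fun i _ => ?_
  have : ∀ k, ((labelMatrix g - M) i k) ^ 2
      = (if g i = k then 1 - 2 * M i k else 0) + M i k ^ 2 := by
    intro k
    simp only [Matrix.sub_apply, labelMatrix_apply]
    split_ifs <;> ring
  simp only [this, Finset.sum_add_distrib]
  simp

/-! ### Stability of the projection. -/

/-- The projection is Lipschitz at a matrix whose rows are separated. -/
lemma separation_mul_norm_proj_sub_le {n K : ℕ} {M M₀ V : Matrix (Fin n) (Fin K) ℝ}
    {h : Fin n → Fin K} {t : ℝ} (ht : 0 < t) (hV : V ∈ proj M) (hh : labelMatrix h ∈ feasible n K)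
    (hsep : ∀ i l, l ≠ h i → t ≤ M₀ i (h i) - M₀ i l) :
    t * ‖V - labelMatrix h‖ ≤ 2 * ‖M - M₀‖ := by
  obtain ⟨hVf, hmin⟩ := hV
  obtain ⟨v, rfl⟩ := exists_labelMatrix hVf
  have h1 := pow_le_pow_left₀ (norm_nonneg _) (hmin _ hh) 2
  rw [frobenius_norm_sq_labelMatrix_sub_matrix, frobenius_norm_sq_labelMatrix_sub_matrix] at h1
  -- Each misassigned row costs at least `t` in the score of `M₀`. Optimality of `V` for `M`
  -- transfers this cost to the inner product of `M - M₀` with the difference of assignments, where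
  -- Cauchy–Schwarz applies.
  have h2 : t * ((Finset.univ.filter fun i => v i ≠ h i).card : ℝ)
      ≤ ∑ i, (M₀ i (h i) - M₀ i (v i)) := by
    rw [Finset.card_filter, Nat.cast_sum, Finset.mul_sum]
    refine Finset.sum_le_sum fun i _ => ?_
    by_cases hi : v i = h i
    · simp [hi]
    · simpa [hi] using hsep i (v i) hi
  have h3 : ∑ i, (M₀ i (h i) - M₀ i (v i)) ≤
      ∑ i, ∑ k, (M - M₀) i k * (labelMatrix v - labelMatrix h) i k := by
    have h4 : ∑ i, ∑ k, (M - M₀) i k * (labelMatrix v - labelMatrix h) i k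
        = ∑ i, (M₀ i (h i) - M₀ i (v i)) + (∑ i, M i (v i) - ∑ i, M i (h i)) := by
      rw [← Finset.sum_sub_distrib, ← Finset.sum_add_distrib]
      refine Finset.sum_congr rfl fun i _ => ?_
      simp [mul_sub, Finset.sum_sub_distrib]
      ring
    rw [h4]
    linarith
  have h5 : (∑ i, ∑ k, (M - M₀) i k * (labelMatrix v - labelMatrix h) i k) ^ 2
      ≤ ‖M - M₀‖ ^ 2 * ‖labelMatrix v - labelMatrix h‖ ^ 2 := by
    rw [frobenius_norm_sq, frobenius_norm_sq]
    simp only [← Finset.sum_product']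
    exact Finset.sum_mul_sq_le_sq_mul_sq _ _ _
  have h6 := frobenius_norm_sq_labelMatrix_sub v h
  set x := ‖labelMatrix v - labelMatrix h‖
  have hx : 0 ≤ x := norm_nonneg _
  have h7 : ∑ i, ∑ k, (M - M₀) i k * (labelMatrix v - labelMatrix h) i k ≤ ‖M - M₀‖ * x := by
    rw [← mul_pow] at h5
    exact (le_abs_self _).trans (abs_le_of_sq_le_sq h5 (by positivity))
  -- The number of misassigned rows is `x ^ 2 / 2`, so one factor `x` cancels when it is nonzero.
  rcases hx.eq_or_lt with h0 | h0
  · rw [← h0]; simp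
  · have : t * x * x ≤ 2 * ‖M - M₀‖ * x := by nlinarith
    exact le_of_mul_le_mul_right this h0

/-! ### The tensor power as a sum over hyperedges and orderings. -/

lemma tensorApply_succ {r n K : ℕ} (A : Tensor (r + 1) n) (H : Matrix (Fin n) (Fin K) ℝ)
    (i : Fin n) (k : Fin K) :
    tensorApply A H i k = ∑ j : Fin r → Fin n, A (Fin.cons i j) * ∏ t, H (j t) k := by
  simp only [tensorApply, Matrix.of_apply, Fin.prod_univ_succ, Fin.val_zero, if_true, Fin.val_succ,
    Nat.succ_ne_zero, if_false]
  rw [← (Fin.consEquiv fun _ : Fin (r + 1) => Fin n).sum_comp, Fintype.sum_prod_type,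
    Finset.sum_eq_single i]
  · simp [Fin.consEquiv]
  · intro b _ hb
    simp [Fin.consEquiv, hb]
  · simp

/-- A sum over injective tuples is a sum over orderings of increasing tuples. -/
lemma sum_eq_sum_perm_orderEmb {d n : ℕ} (f : (Fin d → Fin n) → ℝ)
    (hf : ∀ j, ¬ Function.Injective j → f j = 0) :
    ∑ j, f j = ∑ π : Equiv.Perm (Fin d), ∑ e : Fin d ↪o Fin n, f (e ∘ π) := by
  rw [← Finset.sum_product']
  symm
  refine Finset.sum_of_injOn (fun x : Equiv.Perm (Fin d) × (Fin d ↪o Fin n) => ⇑x.2 ∘ x.1) ?_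
    (by simp) ?_ (by simp)
  · rintro ⟨π, e⟩ - ⟨π', e'⟩ - hx
    simp only at hx
    have hr : Set.range e = Set.range e' := by
      rw [← π.surjective.range_comp e, ← π'.surjective.range_comp e', hx]
    have he : e = e' := OrderEmbedding.range_inj.1 hr
    subst he
    have : π = π' := by
      ext t
      exact congrArg Fin.val (e.injective (congrFun hx t))
    rw [this]
  · intro j _ hj
    refine hf j fun hinj => hj ?_
    -- The preimage of an injective tuple is its sorted version with the inverse of the sorting
    -- permutation.
    have hm : StrictMono (j ∘ Tuple.sort j) :=
      (Tuple.monotone_sort j).strictMono_of_injective (hinj.comp (Tuple.sort j).injective)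
    refine ⟨((Tuple.sort j)⁻¹, OrderEmbedding.ofStrictMono _ hm), by simp, ?_⟩
    funext t
    simp

/-- Only increasing tuples carry independent entries. For a fixed `π`, each hyperedge occurs exactly
once and feeds exactly one row, which makes different rows independent. -/
lemma tensorApply_eq_sum_perm {r n K : ℕ} {A : Tensor (r + 1) n}
    (hsymm : ∀ (σ : Equiv.Perm (Fin (r + 1))) (i : Fin (r + 1) → Fin n), A (i ∘ σ) = A i)
    (hdiag : ∀ i : Fin (r + 1) → Fin n, ¬ Function.Injective i → A i = 0)
    (H : Matrix (Fin n) (Fin K) ℝ) (i : Fin n) (k : Fin K) :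
    tensorApply A H i k = ∑ π : Equiv.Perm (Fin (r + 1)), ∑ e : Fin (r + 1) ↪o Fin n,
      A e * if e (π 0) = i then ∏ t : Fin r, H (e (π t.succ)) k else 0 := by
  simp only [tensorApply, Matrix.of_apply, Fin.prod_univ_succ, Fin.val_zero, if_true, Fin.val_succ,
    Nat.succ_ne_zero, if_false]
  rw [sum_eq_sum_perm_orderEmb]
  · refine Finset.sum_congr rfl fun π _ => Finset.sum_congr rfl fun e _ => ?_
    rw [hsymm]
    simp
  · intro j hj
    rw [hdiag j hj, zero_mul]

/-- The number of injective tuples with given head and with tail in a given set. -/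
lemma card_injective_cons {r n : ℕ} (i : Fin n) (T : Finset (Fin n)) :
    (Finset.univ.filter fun j : Fin r → Fin n =>
      Function.Injective (Fin.cons i j : Fin (r + 1) → Fin n) ∧ ∀ t, j t ∈ T).card
      = (T.erase i).card.descFactorial r := by
  have h := Fintype.card_embedding_eq (α := Fin r) (β := {x // x ∈ T.erase i})
  rw [Fintype.card_coe, Fintype.card_fin] at h
  rw [← h, ← Fintype.card_subtype]
  refine Fintype.card_congr
    { toFun := fun j => ⟨fun t => ⟨j.1 t, ?_⟩, ?_⟩
      invFun := fun f => ⟨fun t => (f t).1, ?_, ?_⟩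
      left_inv := fun _ => rfl
      right_inv := fun _ => rfl }
  · have := (Fin.cons_injective_iff.1 j.2.1).1
    refine Finset.mem_erase.2 ⟨fun h => this ⟨t, h⟩, j.2.2 t⟩
  · intro a b hab
    exact (Fin.cons_injective_iff.1 j.2.1).2 (by simpa using hab)
  · refine Fin.cons_injective_iff.2 ⟨?_, fun a b hab => f.injective (Subtype.ext hab)⟩
    rintro ⟨t, ht⟩
    exact (Finset.mem_erase.1 (f t).2).1 ht
  · exact fun t => (Finset.mem_erase.1 (f t).2).2

-- Bernoulli variables and functions of disjoint blocks.

universe v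

section Bernoulli

variable {Ω : Type v} [MeasurableSpace Ω] {μ : Measure Ω} [IsProbabilityMeasure μ]

omit [IsProbabilityMeasure μ] in
lemma integral_comp_of_map_bernoulli {X : Ω → ℝ} {p : unitInterval} (hX : Measurable X)
    (hlaw : μ.map X = bernoulliMeasure (1 : ℝ) 0 p) {f : ℝ → ℝ} (hf : Measurable f) :
    ∫ ω, f (X ω) ∂μ = p * f 1 + (1 - p) * f 0 := by
  rw [← integral_map (f := f) hX.aemeasurable hf.aestronglyMeasurable, hlaw,
    integral_bernoulliMeasure]
  simp

omit [IsProbabilityMeasure μ] in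
lemma ae_eq_zero_or_one_of_map_bernoulli {X : Ω → ℝ} {p : unitInterval} (hX : Measurable X)
    (hlaw : μ.map X = bernoulliMeasure (1 : ℝ) 0 p) : ∀ᵐ ω ∂μ, X ω = 0 ∨ X ω = 1 := by
  have h : ∀ᵐ x ∂(μ.map X), x = 0 ∨ x = 1 := by
    have hs : MeasurableSet ({x : ℝ | x = 0 ∨ x = 1}ᶜ) := by
      refine MeasurableSet.compl ?_
      exact (measurableSet_singleton (0 : ℝ)).union (measurableSet_singleton 1)
    rw [ae_iff, hlaw]
    exact bernoulliMeasure_apply_of_notMem_of_notMem (X := ℝ) p hs (by simp) (by simp)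
  exact ae_of_ae_map hX.aemeasurable h

/-- A function on blocks of independent variables has a multiplicative moment generating
function. -/
lemma mgf_sum_blocks {ι κ : Type*} {A : ι → Ω → ℝ} (hA : ∀ e, Measurable (A e))
    (hind : iIndepFun A μ) [DecidableEq ι] [DecidableEq κ] (T : κ → Finset ι)
    (hT : ∀ i j, i ≠ j → Disjoint (T i) (T j)) (Φ : ∀ i, (T i → ℝ) → ℝ)
    (hΦ : ∀ i, Measurable (Φ i)) (t : ℝ) (s : Finset κ) :
    mgf (fun ω => ∑ i ∈ s, Φ i fun e => A e ω) μ t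
      = ∏ i ∈ s, mgf (fun ω => Φ i fun e => A e ω) μ t := by
  have hm : ∀ i, Measurable fun ω => Φ i fun e => A e ω := fun i =>
    (hΦ i).comp (measurable_pi_lambda _ fun e => hA e)
  induction s using Finset.induction_on with
  | empty => simp [mgf]
  | insert i s hi ih =>
    rw [Finset.prod_insert hi, ← ih]
    have hd : Disjoint (T i) (s.biUnion T) := by
      rw [Finset.disjoint_biUnion_right]
      intro j hj
      exact hT i j fun h => hi (h ▸ hj)
    have h1 := hind.indepFun_finset (T i) (s.biUnion T) hd hA
    have h2 : Measurable fun f : (s.biUnion T) → ℝ =>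
        ∑ j : s, Φ j fun e : T j => f ⟨e, Finset.mem_biUnion.2 ⟨j, j.2, e.2⟩⟩ := by
      refine Finset.measurable_sum _ fun j _ => (hΦ j).comp ?_
      exact measurable_pi_lambda _ fun e => measurable_pi_apply _
    have h3 := h1.comp (hΦ i) h2
    have h4 : (fun ω => ∑ j ∈ insert i s, Φ j fun e => A e ω)
        = (fun ω => Φ i fun e => A e ω) + fun ω => ∑ j ∈ s, Φ j fun e => A e ω := by
      funext ω
      simp [Finset.sum_insert hi]
    have h5 : ((fun f : (s.biUnion T) → ℝ =>
        ∑ j : s, Φ j fun e : T j => f ⟨e, Finset.mem_biUnion.2 ⟨j, j.2, e.2⟩⟩) ∘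
          fun a (e : (s.biUnion T)) => A e a) = fun ω => ∑ j ∈ s, Φ j fun e => A e ω := by
      funext ω
      simp only [Function.comp_apply]
      rw [Finset.sum_coe_sort s fun j => Φ j fun e : T j => A e ω]
    rw [h5] at h3
    rw [h4]
    exact h3.mgf_add' (hm i).aestronglyMeasurable
      (Finset.measurable_sum _ fun j _ => hm j).aestronglyMeasurable

end Bernoulli

/-! ### Bennett's inequality for signed sums of centred Bernoulli variables. -/

/-- For negative `x` this is $\sinh y\ge y$ at $y=-x$. It lets weights $1$ and $-1$ share one moment
bound. -/
lemma exp_sub_le_exp_abs (x : ℝ) : Real.exp x - 1 - x ≤ Real.exp |x| - 1 - |x| := by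
  rcases le_total 0 x with h | h
  · rw [abs_of_nonneg h]
  · rw [abs_of_nonpos h]
    have := Real.self_le_sinh_iff.2 (neg_nonneg.2 h)
    rw [Real.sinh_eq, neg_neg] at this
    linarith

section CenteredSum

variable {Ω : Type v} [MeasurableSpace Ω] {μ : Measure Ω} [IsProbabilityMeasure μ]
  {ι : Type*} {A : ι → Ω → ℝ} {P : ι → unitInterval}

omit [IsProbabilityMeasure μ] in
lemma mgf_centered_le {X : Ω → ℝ} {p : unitInterval} (hX : Measurable X)
    (hlaw : μ.map X = bernoulliMeasure (1 : ℝ) 0 p) {w : ℝ} (hw : w = 0 ∨ w = 1 ∨ w = -1) (θ : ℝ) :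
    mgf (fun ω => w * (X ω - p)) μ θ
      ≤ Real.exp (p * |w| * (Real.exp |θ| - 1 - |θ|)) := by
  have hp := p.2.1
  have h1 : mgf (fun ω => w * (X ω - p)) μ θ
      = p * Real.exp (θ * (w * (1 - p))) + (1 - p) * Real.exp (θ * (w * (0 - p))) :=
    integral_comp_of_map_bernoulli hX hlaw (f := fun x => Real.exp (θ * (w * (x - p))))
      (by fun_prop)
  rw [h1]
  have h2 : p * Real.exp (θ * (w * (1 - p))) + (1 - p) * Real.exp (θ * (w * (0 - p)))
      = Real.exp (-(θ * w * p)) * (1 + p * (Real.exp (θ * w) - 1)) := by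
    rw [show θ * (w * (1 - p)) = -(θ * w * p) + θ * w by ring,
      show θ * (w * (0 - p)) = -(θ * w * p) by ring, Real.exp_add]
    ring
  rw [h2]
  have h3 : 1 + p * (Real.exp (θ * w) - 1) ≤ Real.exp (p * (Real.exp (θ * w) - 1)) := by
    linarith [Real.add_one_le_exp (p * (Real.exp (θ * w) - 1))]
  refine (mul_le_mul_of_nonneg_left h3 (Real.exp_pos _).le).trans ?_
  rw [← Real.exp_add, Real.exp_le_exp]
  have h4 : Real.exp (θ * w) - 1 - θ * w ≤ |w| * (Real.exp |θ| - 1 - |θ|) := by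
    rcases hw with rfl | rfl | rfl
    · simp
    · simpa using exp_sub_le_exp_abs θ
    · simpa using exp_sub_le_exp_abs (-θ)
  have := mul_le_mul_of_nonneg_left h4 hp
  linarith

omit [IsProbabilityMeasure μ] in
lemma ae_abs_centered_le {X : Ω → ℝ} {p : unitInterval} (hX : Measurable X)
    (hlaw : μ.map X = bernoulliMeasure (1 : ℝ) 0 p) {w : ℝ} (hw : w = 0 ∨ w = 1 ∨ w = -1) :
    ∀ᵐ ω ∂μ, |w * (X ω - p)| ≤ 1 := by
  have hp := p.2.1
  have hp1 := p.2.2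
  filter_upwards [ae_eq_zero_or_one_of_map_bernoulli hX hlaw] with ω hω
  rw [abs_le]
  rcases hw with rfl | rfl | rfl <;> rcases hω with h | h <;> rw [h] <;>
    constructor <;> linarith

variable (hA : ∀ e, Measurable (A e)) (hind : iIndepFun A μ)
  (hlaw : ∀ e, μ.map (A e) = bernoulliMeasure (1 : ℝ) 0 (P e)) (T : Finset ι) {w : ι → ℝ}
  (hw : ∀ e, w e = 0 ∨ w e = 1 ∨ w e = -1)

omit [IsProbabilityMeasure μ] in
include hind in
lemma iIndepFun_centered : iIndepFun (fun e ω => w e * (A e ω - P e)) μ :=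
  hind.comp (fun e x => w e * (x - P e)) fun e => by fun_prop

omit [IsProbabilityMeasure μ] in
include hA hlaw hw in
lemma ae_abs_sum_centered_le : ∀ᵐ ω ∂μ, |∑ e ∈ T, w e * (A e ω - P e)| ≤ T.card := by
  have h : ∀ᵐ ω ∂μ, ∀ e ∈ T, |w e * (A e ω - P e)| ≤ 1 :=
    (Filter.eventually_all_finset T).2 fun e _ => ae_abs_centered_le (hA e) (hlaw e) (hw e)
  filter_upwards [h] with ω hω
  refine (Finset.abs_sum_le_sum_abs _ _).trans ((Finset.sum_le_sum hω).trans ?_)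
  simp

include hA in
lemma measurable_sum_centered : Measurable fun ω => ∑ e ∈ T, w e * (A e ω - P e) :=
  Finset.measurable_sum _ fun e _ => ((hA e).sub_const _).const_mul _

include hA hlaw hw in
lemma integrable_exp_sum_centered (θ : ℝ) :
    Integrable (fun ω => Real.exp (θ * ∑ e ∈ T, w e * (A e ω - P e))) μ := by
  refine integrable_exp_mul_of_mem_Icc (a := -(T.card : ℝ)) (b := T.card)
    (measurable_sum_centered hA T).aemeasurable ?_
  filter_upwards [ae_abs_sum_centered_le hA hlaw T hw] with ω hω
  exact abs_le.1 hω

omit [IsProbabilityMeasure μ] in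
include hA hind hlaw hw in
lemma mgf_sum_centered_le {ν : ℝ} (hν : ∑ e ∈ T, (P e : ℝ) * |w e| ≤ ν) (θ : ℝ) :
    mgf (fun ω => ∑ e ∈ T, w e * (A e ω - P e)) μ θ
      ≤ Real.exp (ν * (Real.exp |θ| - 1 - |θ|)) := by
  have h1 : (fun ω => ∑ e ∈ T, w e * (A e ω - P e))
      = ∑ e ∈ T, fun ω => w e * (A e ω - P e) := by
    funext ω
    simp
  rw [h1, (iIndepFun_centered hind).mgf_sum (fun e => ((hA e).sub_const _).const_mul _)]
  refine (Finset.prod_le_prod (fun _ _ => mgf_nonneg) fun e _ =>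
    mgf_centered_le (hA e) (hlaw e) (hw e) θ).trans ?_
  rw [← Real.exp_sum, ← Finset.sum_mul, Real.exp_le_exp]
  refine mul_le_mul_of_nonneg_right hν ?_
  linarith [Real.add_one_le_exp |θ|]

include hA hind hlaw hw in
/-- Bennett's inequality for centred sums of Bernoulli variables. -/
lemma measure_abs_sum_centered_ge_le {ν : ℝ} (hν0 : 0 < ν)
    (hν : ∑ e ∈ T, (P e : ℝ) * |w e| ≤ ν) {u : ℝ} (hu : 0 < u) :
    μ.real {ω | u ≤ |∑ e ∈ T, w e * (A e ω - P e)|}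
      ≤ 2 * Real.exp (-(u / 2 * Real.log (1 + u / ν))) := by
  set Z : Ω → ℝ := fun ω => ∑ e ∈ T, w e * (A e ω - P e) with hZ
  set θ := Real.log (1 + u / ν) with hθ
  have hx : 0 < u / ν := by positivity
  have hθ0 : 0 ≤ θ := Real.log_nonneg (by linarith)
  have hexp : Real.exp θ = 1 + u / ν := Real.exp_log (by linarith)
  -- The exponent at this `θ` equals $-\theta u+u-\nu\theta$. The bound $\log(1+x)\ge 2x/(x+2)$ at
  -- $x=u/\nu$ says $u-\nu\theta\le\theta u/2$.
  have hkey : -θ * u + ν * (Real.exp |θ| - 1 - |θ|) ≤ -(u / 2 * θ) := by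
    rw [abs_of_nonneg hθ0, hexp]
    have h1 := Real.le_log_one_add_of_nonneg hx.le
    rw [← hθ, div_le_iff₀ (by linarith)] at h1
    have h2 : ν * (u / ν) = u := by field_simp
    have h3 : ν * (2 * (u / ν)) ≤ ν * (θ * (u / ν + 2)) := mul_le_mul_of_nonneg_left h1 hν0.le
    have h4 : ν * (θ * (u / ν + 2)) = θ * u + 2 * (ν * θ) := by
      rw [show ν * (θ * (u / ν + 2)) = θ * (ν * (u / ν)) + 2 * (ν * θ) by ring, h2]
    have h5 : ν * (1 + u / ν - 1 - θ) = u - ν * θ := by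
      rw [show ν * (1 + u / ν - 1 - θ) = ν * (u / ν) - ν * θ by ring, h2]
    rw [h5]
    linarith
  have hup : μ.real {ω | u ≤ Z ω} ≤ Real.exp (-(u / 2 * θ)) := by
    refine (measure_ge_le_exp_mul_mgf u hθ0 (integrable_exp_sum_centered hA hlaw T hw θ)).trans ?_
    refine (mul_le_mul_of_nonneg_left (mgf_sum_centered_le hA hind hlaw T hw hν θ)
      (Real.exp_pos _).le).trans ?_
    rw [← Real.exp_add, Real.exp_le_exp]
    exact hkey
  have hlo : μ.real {ω | Z ω ≤ -u} ≤ Real.exp (-(u / 2 * θ)) := by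
    refine (measure_le_le_exp_mul_mgf (t := -θ) (-u) (by linarith)
      (integrable_exp_sum_centered hA hlaw T hw (-θ))).trans ?_
    refine (mul_le_mul_of_nonneg_left (mgf_sum_centered_le hA hind hlaw T hw hν (-θ))
      (Real.exp_pos _).le).trans ?_
    rw [← Real.exp_add, Real.exp_le_exp, abs_neg]
    linarith [hkey]
  have hsub : {ω | u ≤ |Z ω|} ⊆ {ω | u ≤ Z ω} ∪ {ω | Z ω ≤ -u} := by
    intro ω hω
    rcases le_abs.1 (show u ≤ |Z ω| from hω) with h | h
    · exact Or.inl h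
    · exact Or.inr (show Z ω ≤ -u by linarith)
  calc μ.real {ω | u ≤ |Z ω|} ≤ μ.real ({ω | u ≤ Z ω} ∪ {ω | Z ω ≤ -u}) := measureReal_mono hsub
    _ ≤ _ := measureReal_union_le _ _
    _ ≤ _ := by linarith

include hA hind hlaw hw in
lemma integral_sq_sum_centered_le {ν : ℝ} (hν : ∑ e ∈ T, (P e : ℝ) * |w e| ≤ ν) :
    ∫ ω, (∑ e ∈ T, w e * (A e ω - P e)) ^ 2 ∂μ ≤ ν := by
  have hmem : ∀ e ∈ T, MemLp (fun ω => w e * (A e ω - P e)) 2 μ := fun e _ =>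
    MemLp.of_bound (((hA e).sub_const _).const_mul _).aestronglyMeasurable 1
      (ae_abs_centered_le (hA e) (hlaw e) (hw e))
  have hmean : ∀ e, ∫ ω, w e * (A e ω - P e) ∂μ = 0 := fun e => by
    rw [integral_comp_of_map_bernoulli (hA e) (hlaw e) (f := fun x => w e * (x - P e))
      (by fun_prop)]
    ring
  have hvar : ∀ e, variance (fun ω => w e * (A e ω - P e)) μ ≤ P e * |w e| := fun e => by
    rw [variance_eq_integral (((hA e).sub_const _).const_mul _).aemeasurable, hmean]
    rw [integral_comp_of_map_bernoulli (hA e) (hlaw e) (f := fun x => (w e * (x - P e) - 0) ^ 2)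
      (by fun_prop)]
    have h0 := (P e).2.1
    have h1 := (P e).2.2
    rcases hw e with h | h | h <;> rw [h] <;> simp <;> nlinarith
  have h1 := IndepFun.variance_sum hmem
    fun i _ j _ hij => (iIndepFun_centered (P := P) (w := w) hind).indepFun hij
  have h2 : (∑ e ∈ T, fun ω => w e * (A e ω - P e)) = fun ω => ∑ e ∈ T, w e * (A e ω - P e) := by
    funext ω
    simp
  rw [h2, variance_eq_integral (measurable_sum_centered hA T).aemeasurable,
    integral_finsetSum _ fun e he => (hmem e he).integrable (by norm_num)] at h1
  simp only [hmean, Finset.sum_const_zero, sub_zero] at h1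
  rw [h1]
  exact (Finset.sum_le_sum fun e _ => hvar e).trans hν

end CenteredSum

/-! ### Exponential moments of truncated squares. -/

/-- Half of the Bennett exponent is spent on the exponential moment; this bounds what the other half
leaves. The decay $\nu^2/u^4$ makes dyadic layers, weighted by $u^2$, sum to order $\nu$. For
$u\le\nu$ the exponent is Gaussian, at least $u^2/(6\nu)$; for $u\ge\nu$ the logarithm is at least
$1/2$, and $u\ge16$ leaves room for two powers of $1+u/\nu$ and a factor $e^{-u/16}$. -/
lemma exp_neg_mul_log_le {u ν : ℝ} (hν : 0 < ν) (hu : 16 ≤ u) :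
    Real.exp (-(u / 4 * Real.log (1 + u / ν))) ≤ 512 * ν ^ 2 / u ^ 4 := by
  have hu0 : 0 < u := by linarith
  have hx : 0 < u / ν := by positivity
  have key : ∀ y : ℝ, 0 < y → Real.exp (-y) ≤ 2 / y ^ 2 := by
    intro y hy
    rw [Real.exp_neg, ← one_div, div_le_div_iff₀ (Real.exp_pos _) (by positivity)]
    nlinarith [Real.quadratic_le_exp_of_nonneg hy.le]
  rcases le_total (u / ν) 1 with h | h
  · have h1 := Real.le_log_one_add_of_nonneg hx.le
    have h2 : 2 * (u / ν) / 3 ≤ 2 * (u / ν) / (u / ν + 2) := by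
      gcongr
      linarith
    have h3 : u ^ 2 / (6 * ν) ≤ u / 4 * Real.log (1 + u / ν) := by
      calc u ^ 2 / (6 * ν) = u / 4 * (2 * (u / ν) / 3) := by field_simp; norm_num
        _ ≤ _ := by gcongr; exact h2.trans h1
    calc Real.exp (-(u / 4 * Real.log (1 + u / ν))) ≤ Real.exp (-(u ^ 2 / (6 * ν))) := by
          rw [Real.exp_le_exp]; linarith
      _ ≤ 2 / (u ^ 2 / (6 * ν)) ^ 2 := key _ (by positivity)
      _ = 72 * ν ^ 2 / u ^ 4 := by field_simp; norm_num
      _ ≤ _ := by gcongr; norm_num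
  · have hl2 : 1 / 2 ≤ Real.log 2 := by linarith [Real.log_two_gt_d9]
    have hlog2 : 1 / 2 ≤ Real.log (1 + u / ν) :=
      hl2.trans (Real.log_le_log (by norm_num) (by linarith))
    have h1 : 2 * Real.log (1 + u / ν) + u / 16 ≤ u / 4 * Real.log (1 + u / ν) := by
      nlinarith
    calc Real.exp (-(u / 4 * Real.log (1 + u / ν)))
        ≤ Real.exp (-(2 * Real.log (1 + u / ν)) + -(u / 16)) := by
          rw [Real.exp_le_exp]; linarith
      _ = (1 + u / ν)⁻¹ ^ 2 * Real.exp (-(u / 16)) := by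
          rw [Real.exp_add, ← Real.exp_log (show (0 : ℝ) < 1 + u / ν by linarith), ← Real.exp_neg,
            ← Real.exp_nat_mul, Real.log_exp]
          push_cast
          ring_nf
      _ ≤ (u / ν)⁻¹ ^ 2 * (2 / (u / 16) ^ 2) := by
          gcongr
          · linarith
          · exact key _ (by positivity)
      _ = 512 * ν ^ 2 / u ^ 4 := by field_simp; norm_num

lemma log_one_add_two_mul_le {x : ℝ} (hx : 0 ≤ x) :
    Real.log (1 + 2 * x) ≤ 2 * Real.log (1 + x) := by
  rw [← Real.log_rpow (by linarith)]
  refine Real.log_le_log (by linarith) ?_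
  norm_cast
  nlinarith

/-- `log (1 + x) / x` is decreasing. -/
lemma mul_log_one_add_le {x y : ℝ} (hx : 0 ≤ x) (hxy : x ≤ y) :
    x * Real.log (1 + y) ≤ y * Real.log (1 + x) := by
  rcases hx.eq_or_lt with rfl | hx0
  · simp
  · have hy : 0 < y := hx0.trans_le hxy
    have hxy1 : 0 ≤ 1 - x / y := by
      rw [sub_nonneg, div_le_one hy]
      exact hxy
    have hxy0 : 0 ≤ x / y := by positivity
    have h := strictConcaveOn_log_Ioi.concaveOn.2 (show (1 : ℝ) ∈ Set.Ioi 0 from Set.mem_Ioi.2 zero_lt_one)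
      (show 1 + y ∈ Set.Ioi 0 from Set.mem_Ioi.2 (by linarith)) hxy1 hxy0 (by ring)
    simp only [smul_eq_mul, Real.log_one, mul_zero, zero_add] at h
    rw [show (1 - x / y) * 1 + x / y * (1 + y) = 1 + x by field_simp; ring, div_mul_eq_mul_div,
      div_le_iff₀ hy] at h
    linarith

lemma exp_sub_one_le_mul_exp (x : ℝ) : Real.exp x - 1 ≤ x * Real.exp x := by
  have h := Real.add_one_le_exp (-x)
  have h1 : Real.exp (-x) * Real.exp x = 1 := by rw [← Real.exp_add]; simp
  nlinarith [Real.exp_pos x]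

/-- The pointwise bound behind `mgf_truncated_sq_le`: dyadic layers of a truncated square. -/
lemma exp_truncated_sq_le {ν L u₀ z : ℝ} (hν : 0 < ν) (hL : 0 < L) (hu₀ : 0 < u₀)
    (hsmall : Real.log (1 + L / ν) / (16 * L) * u₀ ^ 2 ≤ 1) {J : ℕ} (hJ : L < 2 ^ J * u₀) :
    Real.exp (Real.log (1 + L / ν) / (16 * L) * if |z| ≤ L then z ^ 2 else 0) ≤
      1 + 3 * (Real.log (1 + L / ν) / (16 * L)) * z ^ 2 +
      ∑ j ∈ Finset.range J, 4 * (Real.log (1 + L / ν) / (16 * L)) * (2 ^ j * u₀) ^ 2 *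
        Real.exp (2 ^ j * u₀ / 4 * Real.log (1 + 2 ^ j * u₀ / ν)) *
          Set.indicator {x : ℝ | 2 ^ j * u₀ ≤ |x|} 1 z := by
  set l := Real.log (1 + L / ν) / (16 * L) with hl
  have hlog : 0 ≤ Real.log (1 + L / ν) := Real.log_nonneg (by
    have : 0 < L / ν := by positivity
    linarith)
  have hl0 : 0 ≤ l := by positivity
  have hterm : ∀ j ∈ Finset.range J, 0 ≤ 4 * l * (2 ^ j * u₀) ^ 2 *
        Real.exp (2 ^ j * u₀ / 4 * Real.log (1 + 2 ^ j * u₀ / ν)) *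
          Set.indicator {x : ℝ | 2 ^ j * u₀ ≤ |x|} 1 z := by
    intro j _
    have : (0 : ℝ) ≤ Set.indicator {x : ℝ | 2 ^ j * u₀ ≤ |x|} 1 z :=
      Set.indicator_nonneg (fun _ _ => zero_le_one) _
    positivity
  have hS := Finset.sum_nonneg hterm
  by_cases hzL : |z| ≤ L
  swap
  · rw [if_neg hzL, mul_zero, Real.exp_zero]
    have : 0 ≤ 3 * l * z ^ 2 := by positivity
    linarith
  rw [if_pos hzL]
  have hE := exp_sub_one_le_mul_exp (l * z ^ 2)
  rcases le_or_gt |z| u₀ with hz | hz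
  · have h1 : l * z ^ 2 ≤ 1 := by
      refine le_trans (mul_le_mul_of_nonneg_left ?_ hl0) hsmall
      rw [← sq_abs]
      gcongr
    have h2 : Real.exp (l * z ^ 2) ≤ 3 :=
      (Real.exp_le_exp.2 h1).trans (by linarith [Real.exp_one_lt_d9])
    have h3 : l * z ^ 2 * Real.exp (l * z ^ 2) ≤ l * z ^ 2 * 3 := by gcongr
    linarith
  -- Locate the dyadic layer $u\le|z|<2u$ with $u=2^ju_0$; a single term of the sum then suffices.
  · obtain ⟨j, hj1, hj2⟩ := exists_nat_pow_near (x := |z| / u₀) (y := 2)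
      ((one_le_div hu₀).2 hz.le) (by norm_num)
    rw [le_div_iff₀ hu₀] at hj1
    rw [div_lt_iff₀ hu₀] at hj2
    set u := 2 ^ j * u₀ with hu
    have hu0 : 0 < u := by positivity
    have hzu : |z| ≤ 2 * u := by
      rw [hu, ← mul_assoc, ← pow_succ']
      exact hj2.le
    have hjJ : j ∈ Finset.range J := by
      rw [Finset.mem_range]
      have h1 : (2 : ℝ) ^ j * u₀ < 2 ^ J * u₀ := (hj1.trans hzL).trans_lt hJ
      have h2 := lt_of_mul_lt_mul_right h1 hu₀.le
      exact (pow_lt_pow_iff_right₀ (by norm_num : (1 : ℝ) < 2)).1 h2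
    have hsingle := Finset.single_le_sum hterm hjJ
    have hind : Set.indicator {x : ℝ | 2 ^ j * u₀ ≤ |x|} (1 : ℝ → ℝ) z = 1 :=
      Set.indicator_of_mem (s := {x : ℝ | 2 ^ j * u₀ ≤ |x|}) hj1 1
    rw [hind, mul_one] at hsingle
    have hz2 : z ^ 2 ≤ 4 * u ^ 2 := by
      rw [← sq_abs]
      nlinarith [abs_nonneg z]
    -- Since $\log(1+x)/x$ decreases and $|z|\le L$, the rate at `L` is at most the rate at `|z|`.
    -- Replacing `|z|` by `2 * u` costs a factor two outside and two inside the logarithm, which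
    -- turns $1/16$ into $1/4$.
    have hexp : l * z ^ 2 ≤ u / 4 * Real.log (1 + u / ν) := by
      have h1 : |z| / ν * Real.log (1 + L / ν) ≤ L / ν * Real.log (1 + |z| / ν) :=
        mul_log_one_add_le (by positivity) (by gcongr)
      have h2 : |z| * Real.log (1 + L / ν) ≤ L * Real.log (1 + |z| / ν) := by
        have := mul_le_mul_of_nonneg_left h1 hν.le
        calc |z| * Real.log (1 + L / ν) = ν * (|z| / ν * Real.log (1 + L / ν)) := by field_simp
          _ ≤ _ := this
          _ = _ := by field_simp
      have h3 : Real.log (1 + |z| / ν) ≤ 2 * Real.log (1 + u / ν) := by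
        refine le_trans (Real.log_le_log (by positivity) ?_)
          (log_one_add_two_mul_le (x := u / ν) (by positivity))
        have : |z| / ν ≤ 2 * u / ν := by gcongr
        rw [mul_div_assoc] at this
        linarith
      have h4 : 0 ≤ Real.log (1 + u / ν) := Real.log_nonneg (by
        have : 0 < u / ν := by positivity
        linarith)
      have h5 : l * z ^ 2 = |z| * (|z| * Real.log (1 + L / ν)) / (16 * L) := by
        rw [hl, ← sq_abs]
        field_simp
      rw [h5, div_le_iff₀ (by positivity)]
      calc |z| * (|z| * Real.log (1 + L / ν)) ≤ |z| * (L * Real.log (1 + |z| / ν)) := by gcongr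
        _ ≤ |z| * (L * (2 * Real.log (1 + u / ν))) := by gcongr
        _ ≤ 2 * u * (L * (2 * Real.log (1 + u / ν))) := by gcongr
        _ = _ := by ring
    have hfin : l * z ^ 2 * Real.exp (l * z ^ 2)
        ≤ 4 * l * u ^ 2 * Real.exp (u / 4 * Real.log (1 + u / ν)) := by
      refine mul_le_mul ?_ (Real.exp_le_exp.2 hexp) (Real.exp_pos _).le (by positivity)
      nlinarith
    have : 0 ≤ 3 * l * z ^ 2 := by positivity
    linarith

/-- The square of a variable with a Bennett tail, truncated at `L`, has an exponential moment of
order `log (1 + L / ν) / (16 L)`. -/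
lemma mgf_truncated_sq_le {Ω : Type v} [MeasurableSpace Ω] {μ : Measure Ω} [IsProbabilityMeasure μ]
    {Z : Ω → ℝ} (hZ : Measurable Z) (hZ2 : Integrable (fun ω => Z ω ^ 2) μ) {ν L : ℝ} (hν : 0 < ν)
    (hL : 0 < L) (hl : Real.log (1 + L / ν) / (16 * L) ≤ 1 / 256)
    (hvar : ∫ ω, Z ω ^ 2 ∂μ ≤ ν)
    (htail : ∀ u, 0 < u → μ.real {ω | u ≤ |Z ω|} ≤ 2 * Real.exp (-(u / 2 * Real.log (1 + u / ν)))) :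
    mgf (fun ω => if |Z ω| ≤ L then Z ω ^ 2 else 0) μ (Real.log (1 + L / ν) / (16 * L))
      ≤ Real.exp (6000 * (Real.log (1 + L / ν) / (16 * L)) * ν) := by
  -- The value 16 is what `exp_neg_mul_log_le` needs, and $\sqrt\nu$ makes $\nu/u^2\le4^{-j}$ on
  -- layer `j`. Both alternatives keep $l u_0^2\le1$.
  set u₀ : ℝ := max (√ν) 16 with hu₀def
  have hu₀16 : 16 ≤ u₀ := le_max_right _ _
  have hu₀ : 0 < u₀ := by linarith
  have hu₀ν : ν ≤ u₀ ^ 2 := by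
    rw [← Real.sq_sqrt hν.le]
    exact pow_le_pow_left₀ (Real.sqrt_nonneg _) (le_max_left _ _) 2
  have hlog : 0 ≤ Real.log (1 + L / ν) := Real.log_nonneg (by
    have : 0 < L / ν := by positivity
    linarith)
  have hsmall : Real.log (1 + L / ν) / (16 * L) * u₀ ^ 2 ≤ 1 := by
    rcases max_choice (√ν) 16 with h | h
    · rw [hu₀def, h, Real.sq_sqrt hν.le, div_mul_eq_mul_div, div_le_one (by positivity)]
      have h1 : Real.log (1 + L / ν) ≤ L / ν := by
        have := Real.log_le_sub_one_of_pos (show 0 < 1 + L / ν by positivity)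
        linarith
      calc Real.log (1 + L / ν) * ν ≤ L / ν * ν := by gcongr
        _ = L := by field_simp
        _ ≤ _ := by linarith
    · rw [hu₀def, h]
      linarith
  obtain ⟨J, hJ⟩ : ∃ J : ℕ, L < 2 ^ J * u₀ := by
    obtain ⟨J, hJ⟩ := pow_unbounded_of_one_lt (L / u₀) (one_lt_two : (1 : ℝ) < 2)
    exact ⟨J, (div_lt_iff₀ hu₀).1 hJ⟩
  have hpt := fun ω => exp_truncated_sq_le (z := Z ω) hν hL hu₀ hsmall hJ
  set l := Real.log (1 + L / ν) / (16 * L) with hldef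
  have hl0 : 0 ≤ l := by positivity
  have hset : ∀ u : ℝ, MeasurableSet {ω | u ≤ |Z ω|} := fun u =>
    measurableSet_le measurable_const hZ.abs
  have hcomp : ∀ u : ℝ, ∀ ω, Set.indicator {x : ℝ | u ≤ |x|} (1 : ℝ → ℝ) (Z ω)
      = Set.indicator {ω | u ≤ |Z ω|} (1 : Ω → ℝ) ω := fun u ω => rfl
  simp only [hcomp] at hpt
  have hintind : ∀ c u : ℝ, Integrable (fun ω => c * Set.indicator {ω | u ≤ |Z ω|} (1 : Ω → ℝ) ω) μ :=
    fun c u => ((integrable_const (1 : ℝ)).indicator (hset u)).const_mul c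
  have hlayer : ∀ j : ℕ, 4 * l * (2 ^ j * u₀) ^ 2 *
      Real.exp (2 ^ j * u₀ / 4 * Real.log (1 + 2 ^ j * u₀ / ν)) * μ.real {ω | 2 ^ j * u₀ ≤ |Z ω|}
      ≤ 4096 * l * ν * (1 / 4) ^ j := by
    intro j
    set u := 2 ^ j * u₀ with hu
    have h2j : (1 : ℝ) ≤ 2 ^ j := one_le_pow₀ (by norm_num)
    have huu : u₀ ≤ u := le_mul_of_one_le_left hu₀.le h2j
    have hu0 : 0 < u := hu₀.trans_le huu
    have h1 := exp_neg_mul_log_le hν (hu₀16.trans huu)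
    calc 4 * l * u ^ 2 * Real.exp (u / 4 * Real.log (1 + u / ν)) * μ.real {ω | u ≤ |Z ω|}
        ≤ 4 * l * u ^ 2 * Real.exp (u / 4 * Real.log (1 + u / ν)) *
          (2 * Real.exp (-(u / 2 * Real.log (1 + u / ν)))) := by
          gcongr
          exact htail u hu0
      _ = 8 * l * u ^ 2 * (Real.exp (u / 4 * Real.log (1 + u / ν)) *
          Real.exp (-(u / 2 * Real.log (1 + u / ν)))) := by ring
      _ = 8 * l * u ^ 2 * Real.exp (-(u / 4 * Real.log (1 + u / ν))) := by
          rw [← Real.exp_add]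
          ring_nf
      _ ≤ 8 * l * u ^ 2 * (512 * ν ^ 2 / u ^ 4) := by gcongr
      _ = 4096 * l * ν * (ν / u ^ 2) := by field_simp; ring
      _ ≤ 4096 * l * ν * (1 / 4) ^ j := by
          gcongr
          rw [div_le_iff₀ (by positivity), hu, mul_pow, ← pow_mul, mul_comm j 2, pow_mul,
            ← mul_assoc, ← mul_pow]
          norm_num
          exact hu₀ν
  have hgeom : ∑ j ∈ Finset.range J, ((1 : ℝ) / 4) ^ j ≤ 4 / 3 := by
    have h1 := mul_neg_geom_sum ((1 : ℝ) / 4) J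
    have : (0 : ℝ) < (1 / 4) ^ J := by positivity
    linarith
  calc mgf (fun ω => if |Z ω| ≤ L then Z ω ^ 2 else 0) μ l
      ≤ ∫ ω, (1 + 3 * l * Z ω ^ 2 + ∑ j ∈ Finset.range J, 4 * l * (2 ^ j * u₀) ^ 2 *
        Real.exp (2 ^ j * u₀ / 4 * Real.log (1 + 2 ^ j * u₀ / ν)) *
          Set.indicator {ω | 2 ^ j * u₀ ≤ |Z ω|} (1 : Ω → ℝ) ω) ∂μ := by
        refine integral_mono_of_nonneg (Filter.Eventually.of_forall fun ω => (Real.exp_pos _).le) ?_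
          (Filter.Eventually.of_forall hpt)
        exact ((integrable_const _).add (hZ2.const_mul _)).add
          (integrable_finsetSum _ fun j _ => hintind _ _)
    _ = 1 + 3 * l * (∫ ω, Z ω ^ 2 ∂μ) + ∑ j ∈ Finset.range J, 4 * l * (2 ^ j * u₀) ^ 2 *
        Real.exp (2 ^ j * u₀ / 4 * Real.log (1 + 2 ^ j * u₀ / ν)) *
          μ.real {ω | 2 ^ j * u₀ ≤ |Z ω|} := by
        have hint : Integrable (fun ω => 1 + 3 * l * Z ω ^ 2) μ :=
          (integrable_const _).add (hZ2.const_mul _)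
        rw [integral_add hint (integrable_finsetSum _ fun j _ => hintind _ _),
          integral_add (integrable_const _) (hZ2.const_mul _),
          integral_finsetSum _ fun j _ => hintind _ _]
        simp only [integral_const_mul, integral_indicator_one (hset _), integral_const, probReal_univ,
          one_smul]
    _ ≤ 1 + 3 * l * ν + ∑ j ∈ Finset.range J, 4096 * l * ν * (1 / 4) ^ j := by
        refine add_le_add ?_ (Finset.sum_le_sum fun j _ => hlayer j)
        gcongr
    -- The constant 6000 dominates $3+4096\cdot\frac43$.
    _ ≤ 1 + 6000 * l * ν := by
        rw [← Finset.mul_sum]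
        have : 4096 * l * ν * ∑ j ∈ Finset.range J, ((1 : ℝ) / 4) ^ j ≤ 4096 * l * ν * (4 / 3) := by
          gcongr
        have : 0 ≤ l * ν := by positivity
        nlinarith
    _ ≤ _ := by linarith [Real.add_one_le_exp (6000 * l * ν)]

/-- Chernoff's bound for a sum of truncated squares over disjoint blocks. -/
lemma measure_sum_truncated_sq_ge_le {Ω : Type v} [MeasurableSpace Ω] {μ : Measure Ω}
    [IsProbabilityMeasure μ] {ι : Type*} [DecidableEq ι] {A : ι → Ω → ℝ} {P : ι → unitInterval}
    (hA : ∀ e, Measurable (A e)) (hind : iIndepFun A μ)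
    (hlaw : ∀ e, μ.map (A e) = bernoulliMeasure (1 : ℝ) 0 (P e)) {n : ℕ} {T : Fin n → Finset ι}
    (hT : ∀ i j, i ≠ j → Disjoint (T i) (T j)) {w : ι → ℝ}
    (hw : ∀ e, w e = 0 ∨ w e = 1 ∨ w e = -1) {ν L : ℝ} (hν : 0 < ν) (hL : 0 < L)
    (hl : Real.log (1 + L / ν) / (16 * L) ≤ 1 / 256)
    (hvar : ∀ i, ∑ e ∈ T i, (P e : ℝ) * |w e| ≤ ν) (t : ℝ) :
    μ.real {ω | t ≤ ∑ i, if |∑ e ∈ T i, w e * (A e ω - P e)| ≤ L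
        then (∑ e ∈ T i, w e * (A e ω - P e)) ^ 2 else 0}
      ≤ Real.exp (-(Real.log (1 + L / ν) / (16 * L)) * t
          + n * (6000 * (Real.log (1 + L / ν) / (16 * L)) * ν)) := by
  have hlog : 0 ≤ Real.log (1 + L / ν) := Real.log_nonneg (by
    have : 0 < L / ν := by positivity
    linarith)
  set l := Real.log (1 + L / ν) / (16 * L) with hldef
  have hl0 : 0 ≤ l := by positivity
  have htrunc : Measurable fun x : ℝ => if |x| ≤ L then x ^ 2 else 0 :=
    Measurable.ite (measurableSet_le measurable_id.abs measurable_const) (by fun_prop) (by fun_prop)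
  set Φ : ∀ i, (T i → ℝ) → ℝ := fun i f =>
    if |∑ e : T i, w e * (f e - P e)| ≤ L then (∑ e : T i, w e * (f e - P e)) ^ 2 else 0 with hΦ
  have hΦm : ∀ i, Measurable (Φ i) := fun i =>
    htrunc.comp (Finset.measurable_sum _ fun e _ =>
      ((measurable_pi_apply e).sub_const _).const_mul _)
  have hΦeq : ∀ i ω, (Φ i fun e => A e ω) = if |∑ e ∈ T i, w e * (A e ω - P e)| ≤ L
        then (∑ e ∈ T i, w e * (A e ω - P e)) ^ 2 else 0 := by
    intro i ω
    simp only [hΦ]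
    rw [Finset.sum_coe_sort (T i) fun e => w e * (A e ω - P e)]
  simp only [← hΦeq]
  have hbd : ∀ i ω, 0 ≤ (Φ i fun e => A e ω) ∧ (Φ i fun e => A e ω) ≤ L ^ 2 := by
    intro i ω
    rw [hΦeq]
    split_ifs with h
    · refine ⟨sq_nonneg _, ?_⟩
      rw [← sq_abs]
      exact pow_le_pow_left₀ (abs_nonneg _) h 2
    · exact ⟨le_rfl, by positivity⟩
  have hm : Measurable fun ω => ∑ i, Φ i fun e => A e ω :=
    Finset.measurable_sum _ fun i _ => (hΦm i).comp (measurable_pi_lambda _ fun e => hA e)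
  have hint : Integrable (fun ω => Real.exp (l * ∑ i, Φ i fun e => A e ω)) μ := by
    refine integrable_exp_mul_of_mem_Icc (a := 0) (b := n * L ^ 2) hm.aemeasurable
      (Filter.Eventually.of_forall fun ω => ⟨Finset.sum_nonneg fun i _ => (hbd i ω).1, ?_⟩)
    refine (Finset.sum_le_sum fun i _ => (hbd i ω).2).trans ?_
    simp
  refine (measure_ge_le_exp_mul_mgf t hl0 hint).trans ?_
  rw [mgf_sum_blocks hA hind T hT Φ hΦm, Real.exp_add]
  refine mul_le_mul_of_nonneg_left ?_ (Real.exp_pos _).le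
  have hone : ∀ i, mgf (fun ω => Φ i fun e => A e ω) μ l ≤ Real.exp (6000 * l * ν) := by
    intro i
    simp only [hΦeq]
    refine mgf_truncated_sq_le (measurable_sum_centered hA (T i)) ?_ hν hL hl
      (integral_sq_sum_centered_le hA hind hlaw (T i) hw (hvar i))
      fun u hu => measure_abs_sum_centered_ge_le hA hind hlaw (T i) hw hν (hvar i) hu
    refine (MemLp.of_bound (p := 2) (measurable_sum_centered hA (T i)).aestronglyMeasurable
      ((T i).card : ℝ) ?_).integrable_sq
    exact ae_abs_sum_centered_le hA hlaw (T i) hw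
  refine (Finset.prod_le_prod (fun _ _ => mgf_nonneg) fun i _ => hone i).trans ?_
  rw [Finset.prod_const, Finset.card_univ, Fintype.card_fin, ← Real.exp_nat_mul]

/-! ### Counting hyperedges and labellings. -/

section Counting

/-- The number of tuples from `W` with an entry in `D`. -/
lemma card_piFinset_exists_mem_le {β : Type*} [DecidableEq β] (r : ℕ) (W D : Finset β) :
    ((Fintype.piFinset fun _ : Fin r => W).filter fun j => ∃ t, j t ∈ D).card
      ≤ r * (W.card ^ (r - 1) * D.card) := by
  have hsub : ((Fintype.piFinset fun _ : Fin r => W).filter fun j => ∃ t, j t ∈ D) ⊆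
      Finset.univ.biUnion fun t : Fin r =>
        Fintype.piFinset fun t' : Fin r => if t' = t then D else W := by
    intro j hj
    rw [Finset.mem_filter, Fintype.mem_piFinset] at hj
    obtain ⟨hj, t, ht⟩ := hj
    refine Finset.mem_biUnion.2 ⟨t, Finset.mem_univ _, Fintype.mem_piFinset.2 fun t' => ?_⟩
    split_ifs with h
    · rw [h]; exact ht
    · exact hj t'
  refine (Finset.card_le_card hsub).trans (Finset.card_biUnion_le.trans ?_)
  refine (Finset.sum_le_card_nsmul _ _ (W.card ^ (r - 1) * D.card) fun t _ => ?_).trans ?_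
  · rw [Fintype.card_piFinset, ← Finset.mul_prod_erase _ _ (Finset.mem_univ t), if_pos rfl, mul_comm]
    refine Nat.mul_le_mul_right _ (le_of_eq ?_)
    rw [Finset.prod_congr rfl (g := fun _ => W.card), Finset.prod_const,
      Finset.card_erase_of_mem (Finset.mem_univ _), Finset.card_univ, Fintype.card_fin]
    intro t' ht'
    rw [if_neg (Finset.ne_of_mem_erase ht')]
  · simp

variable {r n K : ℕ}

/-- The edges whose `π 0`-th smallest vertex is `i`. -/
noncomputable def edgesAt (π : Equiv.Perm (Fin (r + 1))) (i : Fin n) : Finset (Fin (r + 1) ↪o Fin n) :=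
  Finset.univ.filter fun e => e (π 0) = i

@[simp]
lemma mem_edgesAt {π : Equiv.Perm (Fin (r + 1))} {i : Fin n} {e : Fin (r + 1) ↪o Fin n} :
    e ∈ edgesAt π i ↔ e (π 0) = i := by
  simp [edgesAt]

lemma disjoint_edgesAt (π : Equiv.Perm (Fin (r + 1))) (i j : Fin n) (hij : i ≠ j) :
    Disjoint (edgesAt π i) (edgesAt π j) := by
  rw [Finset.disjoint_left]
  intro e hi hj
  rw [mem_edgesAt] at hi hj
  exact hij (hi.symm.trans hj)

lemma injOn_edgesAt (π : Equiv.Perm (Fin (r + 1))) (i : Fin n) :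
    Set.InjOn (fun (e : Fin (r + 1) ↪o Fin n) (t : Fin r) => e (π t.succ)) (edgesAt π i) := by
  intro e he e' he' h
  rw [Finset.mem_coe, mem_edgesAt] at he he'
  have h1 : ∀ t, e (π t) = e' (π t) := by
    intro t
    refine Fin.cases ?_ (fun t => congrFun h t) t
    rw [he, he']
  ext t
  have := h1 (π.symm t)
  rw [π.apply_symm_apply] at this
  rw [this]

lemma card_edgesAt_le (π : Equiv.Perm (Fin (r + 1))) (i : Fin n) :
    (edgesAt π i).card ≤ n ^ r := by
  rw [← Finset.card_image_of_injOn (injOn_edgesAt π i)]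
  refine (Finset.card_le_univ _).trans ?_
  simp

lemma card_edgesAt_filter_le (π : Equiv.Perm (Fin (r + 1))) (i : Fin n) (S : Finset (Fin n)) :
    ((edgesAt π i).filter fun e => ∃ t : Fin r, e (π t.succ) ∈ S).card
      ≤ r * (n ^ (r - 1) * S.card) := by
  have hinj := (injOn_edgesAt π i).mono
    (Finset.coe_subset.2 (Finset.filter_subset (fun e => ∃ t : Fin r, e (π t.succ) ∈ S) _))
  rw [← Finset.card_image_of_injOn hinj]
  have h := card_piFinset_exists_mem_le r Finset.univ S
  rw [Finset.card_univ, Fintype.card_fin] at h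
  refine (Finset.card_le_card ?_).trans h
  intro j hj
  obtain ⟨e, he, rfl⟩ := Finset.mem_image.1 hj
  refine Finset.mem_filter.2 ⟨by simp, (Finset.mem_filter.1 he).2⟩

/-- The number of labellings at Hamming distance `s` from a given one. -/
lemma card_hamming_le (g : Fin n → Fin K) {s : ℕ} (hs : 1 ≤ s) (hsn : s ≤ n) :
    ((Finset.univ.filter fun h : Fin n → Fin K =>
      (Finset.univ.filter fun i => h i ≠ g i).card = s).card : ℝ)
      ≤ Real.exp (s * Real.log (n / s) + K * s) := by
  have hs0 : (0 : ℝ) < s := by exact_mod_cast hs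
  have hn0 : (0 : ℝ) < n := by exact_mod_cast hs.trans hsn
  -- Generating function in the Hamming distance: the sum of $x^{\mathrm{dist}(h,g)}$ factorises
  -- over vertices and is at most $e^{Kxn}$. The choice $x=s/n$ makes this $e^{Ks}$, and the
  -- level-$s$ terms alone contribute their number times $(s/n)^s$.
  set x : ℝ := s / n with hx
  have hx0 : 0 < x := by positivity
  have hsum : ∑ h : Fin n → Fin K, ∏ i, (if h i ≠ g i then x else 1) ≤ Real.exp (K * s) := by
    have h1 : ∑ h : Fin n → Fin K, ∏ i, (if h i ≠ g i then x else 1)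
        = ∏ i, ∑ k, (if k ≠ g i then x else 1) := by
      rw [Finset.prod_univ_sum, Fintype.piFinset_univ]
    have h2 : ∀ i, ∑ k, (if k ≠ g i then x else 1) ≤ Real.exp (K * x) := by
      intro i
      calc ∑ k, (if k ≠ g i then x else 1) ≤ ∑ k, (x + if k = g i then 1 else 0) := by
            refine Finset.sum_le_sum fun k _ => ?_
            by_cases h : k = g i <;> simp [h, hx0.le]
        _ = K * x + 1 := by simp [Finset.sum_add_distrib]
        _ ≤ _ := Real.add_one_le_exp _
    rw [h1]
    refine (Finset.prod_le_prod (fun i _ => Finset.sum_nonneg fun k _ => ?_) fun i _ => h2 i).trans ?_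
    · split_ifs <;> positivity
    · rw [Finset.prod_const, Finset.card_univ, Fintype.card_fin, ← Real.exp_nat_mul,
        Real.exp_le_exp, hx]
      apply le_of_eq
      field_simp
  have hprod : ∀ h : Fin n → Fin K, ∏ i, (if h i ≠ g i then x else 1)
      = x ^ (Finset.univ.filter fun i => h i ≠ g i).card := by
    intro h
    rw [Finset.prod_ite]
    simp
  have hle : ((Finset.univ.filter fun h : Fin n → Fin K =>
      (Finset.univ.filter fun i => h i ≠ g i).card = s).card : ℝ) * x ^ s ≤ Real.exp (K * s) := by
    refine le_trans ?_ hsum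
    rw [← nsmul_eq_mul, ← Finset.sum_const]
    refine le_trans (le_of_eq (Finset.sum_congr rfl fun h hh => ?_))
      (Finset.sum_le_sum_of_subset_of_nonneg (Finset.filter_subset _ _) fun h _ _ => ?_)
    · rw [hprod, (Finset.mem_filter.1 hh).2]
    · rw [hprod]; positivity
  have hxs : x ^ s = Real.exp (-(s * Real.log (n / s))) := by
    rw [← Real.rpow_natCast, Real.rpow_def_of_pos hx0, hx, ← inv_div (n : ℝ) s, Real.log_inv]
    ring_nf
  rw [hxs] at hle
  rw [Real.exp_add]
  have hpos := Real.exp_pos (s * Real.log (n / s))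
  have h1 : Real.exp (s * Real.log (n / s)) * Real.exp (-(s * Real.log (n / s))) = 1 := by
    rw [← Real.exp_add]; simp
  calc _ = Real.exp (s * Real.log (n / s)) * (_ * Real.exp (-(s * Real.log (n / s)))) := by
        rw [mul_left_comm, h1, mul_one]
    _ ≤ _ := mul_le_mul_of_nonneg_left hle hpos.le

end Counting

/-! ### Edge laws, the noise, and the entropy of labellings. -/

variable {r n K : ℕ}

/-- The probability of a hyperedge when the planted partition has labels `g`. -/
noncomputable def edgeProb (p q : unitInterval) (g : Fin n → Fin K) (e : Fin (r + 1) → Fin n) :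
    unitInterval :=
  if ∀ t, g (e t) = g (e 0) then p else q

lemma sum_prod_labelMatrix (g : Fin n → Fin K) (e : Fin (r + 1) → Fin n) :
    ∑ k, ∏ t, labelMatrix g (e t) k = if ∀ t, g (e t) = g (e 0) then 1 else 0 := by
  simp only [labelMatrix_apply, Finset.prod_ite_zero, Finset.prod_const_one, Finset.mem_univ,
    true_imp_iff]
  rw [Finset.sum_eq_single (g (e 0))]
  · intro k _ hk
    rw [if_neg fun h => hk (h 0).symm]
  · simp

section Law

variable {Ω : Type v} [MeasurableSpace Ω] {μ : Measure Ω} {p q : unitInterval} {g : Fin n → Fin K}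
  {A : Ω → Tensor (r + 1) n}

lemma IsHSBM.map_edge (hA : IsHSBM μ p q (labelMatrix g) A) (e : Fin (r + 1) ↪o Fin n) :
    μ.map (fun ω => A ω e) = bernoulliMeasure (1 : ℝ) 0 (edgeProb p q g e) := by
  rw [hA.law e, sum_prod_labelMatrix, edgeProb]
  congr 1
  by_cases h : ∀ t, g (e t) = g (e 0)
  · simp only [if_pos h, if_true]
  · simp only [if_neg h, zero_ne_one, if_false]

lemma IsHSBM.measurable_edge (hA : IsHSBM μ p q (labelMatrix g) A) (e : Fin (r + 1) ↪o Fin n) :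
    Measurable fun ω => A ω e :=
  (measurable_pi_apply _).comp hA.measurable

/-- Lying in one community is insensitive to the names of the communities. -/
lemma IsHSBM.perm (hA : IsHSBM μ p q (labelMatrix g) A) (σ : Equiv.Perm (Fin K)) :
    IsHSBM μ p q (labelMatrix (σ ∘ g)) A where
  measurable := hA.measurable
  symmetric := hA.symmetric
  diagonal := hA.diagonal
  indep := hA.indep
  law e := by
    rw [hA.law e, sum_prod_labelMatrix, sum_prod_labelMatrix]
    simp

end Law

/-- The change of the weight of an edge when the labels `g` are replaced by `h`. -/
noncomputable def weightDiff (g h : Fin n → Fin K) (k : Fin K) (π : Equiv.Perm (Fin (r + 1)))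
    (e : Fin (r + 1) ↪o Fin n) : ℝ :=
  ∏ t : Fin r, labelMatrix h (e (π t.succ)) k - ∏ t : Fin r, labelMatrix g (e (π t.succ)) k

lemma prod_labelMatrix_eq (h : Fin n → Fin K) (k : Fin K) (j : Fin r → Fin n) :
    ∏ t : Fin r, labelMatrix h (j t) k = if ∀ t, h (j t) = k then 1 else 0 := by
  simp [Finset.prod_ite_zero]

lemma weightDiff_eq (g h : Fin n → Fin K) (k : Fin K) (π : Equiv.Perm (Fin (r + 1)))
    (e : Fin (r + 1) ↪o Fin n) :
    weightDiff g h k π e = 0 ∨ weightDiff g h k π e = 1 ∨ weightDiff g h k π e = -1 := by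
  rw [weightDiff, prod_labelMatrix_eq h k fun t => e (π t.succ),
    prod_labelMatrix_eq g k fun t => e (π t.succ)]
  split_ifs <;> simp

lemma abs_weightDiff_le (g h : Fin n → Fin K) (k : Fin K) (π : Equiv.Perm (Fin (r + 1)))
    (e : Fin (r + 1) ↪o Fin n) :
    |weightDiff g h k π e| ≤ if ∃ t : Fin r, e (π t.succ) ∈ Finset.univ.filter fun i => h i ≠ g i
      then 1 else 0 := by
  split_ifs with hex
  · rcases weightDiff_eq g h k π e with h | h | h <;> rw [h] <;> simp
  · push Not at hex
    have heq : ∀ t : Fin r, h (e (π t.succ)) = g (e (π t.succ)) := by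
      intro t
      simpa using hex t
    simp [weightDiff, heq]

/-- The centred change of one ordering's contribution to an entry of the tensor power. -/
noncomputable def noiseSum (a : Tensor (r + 1) n) (p q : unitInterval) (g h : Fin n → Fin K)
    (k : Fin K) (π : Equiv.Perm (Fin (r + 1))) (i : Fin n) : ℝ :=
  ∑ e ∈ edgesAt π i, weightDiff g h k π e * (a e - edgeProb p q g e)

lemma edgeProb_le {p q : unitInterval} (hqp : (q : ℝ) ≤ p) (g : Fin n → Fin K)
    (e : Fin (r + 1) → Fin n) : (edgeProb p q g e : ℝ) ≤ p := by
  rw [edgeProb]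
  split_ifs
  · exact le_rfl
  · exact hqp

lemma sum_edgeProb_le {p q : unitInterval} (hqp : (q : ℝ) ≤ p) (g : Fin n → Fin K)
    (π : Equiv.Perm (Fin (r + 1))) (i : Fin n) :
    ∑ e ∈ edgesAt π i, (edgeProb p q g e : ℝ) ≤ p * n ^ r := by
  refine (Finset.sum_le_sum fun (e : Fin (r + 1) ↪o Fin n) _ => edgeProb_le hqp g e).trans ?_
  rw [Finset.sum_const, nsmul_eq_mul, mul_comm]
  refine mul_le_mul_of_nonneg_left ?_ p.2.1
  exact_mod_cast card_edgesAt_le π i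

/-- This is the variance proxy of a block. Only hyperedges with a relabelled vertex in the tail
change weight, so the proxy is proportional to the number of relabelled vertices. -/
lemma sum_edgeProb_mul_weightDiff_le {p q : unitInterval} (hqp : (q : ℝ) ≤ p)
    (g h : Fin n → Fin K) (k : Fin K) (π : Equiv.Perm (Fin (r + 1))) (i : Fin n) :
    ∑ e ∈ edgesAt π i, (edgeProb p q g e : ℝ) * |weightDiff g h k π e|
      ≤ p * (r * (n ^ (r - 1) * ((Finset.univ.filter fun i => h i ≠ g i).card : ℝ))) := by
  have h1 : ∀ e ∈ edgesAt π i, (edgeProb p q g e : ℝ) * |weightDiff g h k π e| ≤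
      p * if ∃ t : Fin r, e (π t.succ) ∈ Finset.univ.filter fun i => h i ≠ g i
      then 1 else 0 := fun e _ =>
    mul_le_mul (edgeProb_le hqp g e) (abs_weightDiff_le g h k π e) (abs_nonneg _) p.2.1
  refine (Finset.sum_le_sum h1).trans ?_
  rw [← Finset.mul_sum, Finset.sum_boole]
  refine mul_le_mul_of_nonneg_left ?_ p.2.1
  exact_mod_cast card_edgesAt_filter_le π i (Finset.univ.filter fun i => h i ≠ g i)

/-- Converts the entropy cost at any distance $s\ge1$ into a power of $n$, through $\log s\le s-1$.
-/
lemma log_le_mul_one_add_log_div {s n : ℕ} (hs : 1 ≤ s) (hsn : s ≤ n) :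
    Real.log n ≤ s * (1 + Real.log (n / s)) := by
  have hs1 : (1 : ℝ) ≤ s := by exact_mod_cast hs
  have hsn' : (s : ℝ) ≤ n := by exact_mod_cast hsn
  rw [Real.log_div (by linarith) (by linarith)]
  have h1 : Real.log s ≤ Real.log n := Real.log_le_log (by linarith) hsn'
  have h2 : Real.log s ≤ s - 1 := Real.log_le_sub_one_of_pos (by linarith)
  nlinarith

/-- The union bound over labellings. -/
lemma sum_exp_hamming_le (hK : 1 ≤ K) (hn : 1 ≤ n) (g : Fin n → Fin K) :
    ∑ h ∈ Finset.univ.filter (fun h : Fin n → Fin K => h ≠ g),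
      Real.exp (-((K + 3) * (((Finset.univ.filter fun i => h i ≠ g i).card : ℝ) *
        (1 + Real.log (n / ((Finset.univ.filter fun i => h i ≠ g i).card : ℝ))))))
      ≤ 1 / (n : ℝ) ^ 2 := by
  have hK1 : (1 : ℝ) ≤ K := by exact_mod_cast hK
  have hn0 : (0 : ℝ) < n := by exact_mod_cast hn
  have hmaps : ∀ h ∈ Finset.univ.filter (fun h : Fin n → Fin K => h ≠ g),
      (Finset.univ.filter fun i => h i ≠ g i).card ∈ Finset.Icc 1 n := by
    intro h hh
    rw [Finset.mem_Icc]
    constructor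
    · obtain ⟨i, hi⟩ := Function.ne_iff.1 (Finset.mem_filter.1 hh).2
      exact Finset.card_pos.2 ⟨i, by simpa using hi⟩
    · exact (Finset.card_le_univ _).trans (by simp)
  rw [← Finset.sum_fiberwise_of_maps_to hmaps]
  have hterm : ∀ s ∈ Finset.Icc 1 n, ∑ h ∈ (Finset.univ.filter (fun h : Fin n → Fin K => h ≠ g)).filter
      (fun h => (Finset.univ.filter fun i => h i ≠ g i).card = s),
      Real.exp (-((K + 3) * (((Finset.univ.filter fun i => h i ≠ g i).card : ℝ) *
        (1 + Real.log (n / ((Finset.univ.filter fun i => h i ≠ g i).card : ℝ))))))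
      ≤ 1 / (n : ℝ) ^ 3 := by
    intro s hs
    rw [Finset.mem_Icc] at hs
    have hs0 : (0 : ℝ) < s := by exact_mod_cast hs.1
    have hcard := card_hamming_le g hs.1 hs.2
    have hlog0 : 0 ≤ Real.log (n / s) := Real.log_nonneg (by
      rw [one_le_div hs0]; exact_mod_cast hs.2)
    calc _ = ∑ h ∈ (Finset.univ.filter (fun h : Fin n → Fin K => h ≠ g)).filter
          (fun h => (Finset.univ.filter fun i => h i ≠ g i).card = s),
          Real.exp (-((K + 3) * ((s : ℝ) * (1 + Real.log (n / s))))) := by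
          refine Finset.sum_congr rfl fun h hh => ?_
          rw [(Finset.mem_filter.1 hh).2]
      _ ≤ Real.exp (s * Real.log (n / s) + K * s) *
          Real.exp (-((K + 3) * ((s : ℝ) * (1 + Real.log (n / s))))) := by
          rw [Finset.sum_const, nsmul_eq_mul]
          refine mul_le_mul_of_nonneg_right (le_trans ?_ hcard) (Real.exp_pos _).le
          exact_mod_cast Finset.card_le_card (Finset.filter_subset_filter _ (Finset.subset_univ _))
      -- The share `K` of `K + 3` pays for the number of labellings; the share 3 gives $n^{-3}$,
      -- leaving $n^{-2}$ after summing over the $n$ distances.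
      _ ≤ Real.exp (-(3 * Real.log n)) := by
          rw [← Real.exp_add, Real.exp_le_exp]
          have := log_le_mul_one_add_log_div hs.1 hs.2
          have h2 : 0 ≤ (K - 1) * (s * Real.log (n / s)) :=
            mul_nonneg (by linarith) (by positivity)
          nlinarith
      _ = 1 / (n : ℝ) ^ 3 := by
          rw [Real.exp_neg, mul_comm, Real.exp_mul, Real.exp_log hn0, one_div]
          norm_cast
  refine (Finset.sum_le_sum hterm).trans ?_
  rw [Finset.sum_const, nsmul_eq_mul, Nat.card_Icc, Nat.add_sub_cancel]
  apply le_of_eq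
  field_simp

/-! ### High-probability bounds for the noise. -/

section Events

variable {Ω : Type v} [MeasurableSpace Ω] {μ : Measure Ω} [IsProbabilityMeasure μ]
  {p q : unitInterval} {g : Fin n → Fin K} {A : Ω → Tensor (r + 1) n} {α : ℝ}

/-- Degrees are of logarithmic order. -/
lemma IsHSBM.measure_degree_ge_le (hA : IsHSBM μ p q (labelMatrix g) A) (hα : 0 < α) (hn : 3 ≤ n)
    (hp : (p : ℝ) = α * Real.log n / (n : ℝ) ^ r) (hqp : (q : ℝ) ≤ p)
    (π : Equiv.Perm (Fin (r + 1))) (i : Fin n) :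
    μ.real {ω | (6 + 2 * α) * Real.log n ≤
      |∑ e ∈ edgesAt π i, (1 : ℝ) * (A ω e - edgeProb p q g e)|} ≤ 2 / (n : ℝ) ^ 3 := by
  have hn3 : (3 : ℝ) ≤ n := by exact_mod_cast hn
  have hn0 : (0 : ℝ) < n := by linarith
  have hlog : 0 < Real.log n := Real.log_pos (by linarith)
  have hν : ∑ e ∈ edgesAt π i, (edgeProb p q g e : ℝ) * |(1 : ℝ)| ≤ α * Real.log n := by
    simp only [abs_one, mul_one]
    refine (sum_edgeProb_le hqp g π i).trans (le_of_eq ?_)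
    rw [hp]
    field_simp
  refine (measure_abs_sum_centered_ge_le (A := fun (e : Fin (r + 1) ↪o Fin n) ω => A ω e)
    (P := fun e => edgeProb p q g e)
    hA.measurable_edge hA.indep hA.map_edge (edgesAt π i) (w := fun _ => 1)
    (fun _ => Or.inr (Or.inl rfl)) (by positivity) hν (by positivity)).trans ?_
  -- Deviation over variance proxy is at least 2 and $e<3$, so Bennett gives half the deviation,
  -- which exceeds $3\log n$.
  have h3 : 1 ≤ Real.log (1 + (6 + 2 * α) * Real.log n / (α * Real.log n)) := by
    rw [Real.le_log_iff_exp_le (by positivity)]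
    have : 2 ≤ (6 + 2 * α) * Real.log n / (α * Real.log n) := by
      rw [le_div_iff₀ (by positivity)]
      nlinarith
    linarith [Real.exp_one_lt_d9]
  have h4 : 2 / (n : ℝ) ^ 3 = 2 * Real.exp (-(3 * Real.log n)) := by
    rw [Real.exp_neg, mul_comm 3, Real.exp_mul, Real.exp_log hn0, div_eq_mul_inv]
    norm_cast
  rw [h4]
  refine mul_le_mul_of_nonneg_left (Real.exp_le_exp.2 ?_) zero_le_two
  have h5 := mul_le_mul_of_nonneg_left h3
    (show 0 ≤ (6 + 2 * α) * Real.log n / 2 by positivity)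
  have : 0 ≤ α * Real.log n := by positivity
  linarith

/-- Concentration of the truncated noise at one labelling. -/
lemma IsHSBM.measure_truncated_noise_ge_le (hA : IsHSBM μ p q (labelMatrix g) A) (hα : 0 < α)
    (hr : 1 ≤ r) (hn : 3 ≤ n) (hnα : 1 + (32 + 4 * α + 3 * r * α) / (r * α) ≤ n)
    (hp : (p : ℝ) = α * Real.log n / (n : ℝ) ^ r) (hqp : (q : ℝ) ≤ p) {h : Fin n → Fin K}
    (hh : h ≠ g) (k : Fin K) (π : Equiv.Perm (Fin (r + 1))) :
    μ.real {ω | (6000 * r * α + 16 * (32 + 4 * α + 3 * r * α) * (K + 3)) *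
        (((Finset.univ.filter fun i => h i ≠ g i).card : ℝ) * Real.log n) ≤
      ∑ i, if |noiseSum (A ω) p q g h k π i| ≤ (32 + 4 * α + 3 * r * α) * Real.log n
        then noiseSum (A ω) p q g h k π i ^ 2 else 0} ≤
      Real.exp (-((K + 3) * (((Finset.univ.filter fun i => h i ≠ g i).card : ℝ) *
        (1 + Real.log (n / ((Finset.univ.filter fun i => h i ≠ g i).card : ℝ)))))) := by
  have hn3 : (3 : ℝ) ≤ n := by exact_mod_cast hn
  have hn0 : (0 : ℝ) < n := by linarith
  have hlog : 0 < Real.log n := Real.log_pos (by linarith)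
  have hr1 : (1 : ℝ) ≤ r := by exact_mod_cast hr
  have hr0 : (0 : ℝ) < r := by linarith
  have hvar := sum_edgeProb_mul_weightDiff_le (r := r) hqp g h k π
  have hs1 : (1 : ℝ) ≤ ((Finset.univ.filter fun i => h i ≠ g i).card : ℝ) := by
    obtain ⟨i, hi⟩ := Function.ne_iff.1 hh
    exact_mod_cast Finset.card_pos.2 ⟨i, by simpa using hi⟩
  have hsn : ((Finset.univ.filter fun i => h i ≠ g i).card : ℝ) ≤ n := by
    exact_mod_cast (Finset.card_le_univ _).trans (by simp)
  set s : ℝ := ((Finset.univ.filter fun i => h i ≠ g i).card : ℝ) with hs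
  have hs0 : 0 < s := by linarith
  -- The summand 32 forces the moment order below $1/256$; $3r\alpha$ gives $L/\nu\ge 3n/s\ge
  -- e\,n/s$; $32+4\alpha$ dominates the block size allowed by the degree bound.
  set cL : ℝ := 32 + 4 * α + 3 * r * α with hcL
  have hcL0 : 0 < cL := by positivity
  have hcL32 : 32 ≤ cL := by
    have : 0 < r * α := by positivity
    rw [hcL]; nlinarith
  set ν : ℝ := r * α * s * Real.log n / n with hνdef
  have hν : 0 < ν := by positivity
  have hpν : (p : ℝ) * (r * (n ^ (r - 1) * s)) = ν := by
    rw [hp, hνdef]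
    obtain ⟨r', rfl⟩ : ∃ r', r = r' + 1 := ⟨r - 1, by omega⟩
    rw [Nat.add_sub_cancel, pow_succ]
    field_simp
  rw [hpν] at hvar
  have hratio : cL * Real.log n / ν = cL * n / (r * α * s) := by
    rw [hνdef]
    field_simp
  have hL : 0 < cL * Real.log n := by positivity
  have hl : Real.log (1 + cL * Real.log n / ν) / (16 * (cL * Real.log n)) ≤ 1 / 256 := by
    have h1 : 1 + cL * Real.log n / ν ≤ (n : ℝ) ^ 2 := by
      rw [hratio]
      have h2 : cL * n / (r * α * s) ≤ cL * n / (r * α) := by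
        exact div_le_div_of_nonneg_left (by positivity) (by positivity)
          (le_mul_of_one_le_right (by positivity) hs1)
      have h3 : cL * n / (r * α) = cL / (r * α) * n := by ring
      have h4 : 0 < cL / (r * α) := by positivity
      nlinarith
    have h2 : Real.log (1 + cL * Real.log n / ν) ≤ 2 * Real.log n := by
      refine (Real.log_le_log (by positivity) h1).trans (le_of_eq ?_)
      rw [Real.log_pow]
      norm_num
    rw [div_le_iff₀ (by positivity)]
    nlinarith
  have hmain := measure_sum_truncated_sq_ge_le
    (A := fun (e : Fin (r + 1) ↪o Fin n) ω => A ω e) (P := fun e => edgeProb p q g e)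
    hA.measurable_edge hA.indep hA.map_edge (disjoint_edgesAt π) (w := weightDiff g h k π)
    (weightDiff_eq g h k π) hν hL hl hvar
    ((6000 * r * α + 16 * cL * (K + 3)) * (s * Real.log n))
  refine hmain.trans ?_
  rw [Real.exp_le_exp]
  have hx : 1 + Real.log (n / s) ≤ Real.log (1 + cL * Real.log n / ν) := by
    have h1 : Real.exp 1 * (n / s) ≤ 1 + cL * Real.log n / ν := by
      rw [hratio]
      have h2 : 3 * (n / s) ≤ cL * n / (r * α * s) := by
        rw [le_div_iff₀ (by positivity)]
        have : 3 * (n / s) * (r * α * s) = (3 * r * α) * n := by field_simp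
        rw [this]
        gcongr
        rw [hcL]; linarith
      have h3 : Real.exp 1 * (n / s) ≤ 3 * (n / s) := by
        gcongr
        linarith [Real.exp_one_lt_d9]
      linarith
    have h2 := Real.log_le_log (by positivity) h1
    rwa [Real.log_mul (Real.exp_ne_zero _) (by positivity), Real.log_exp] at h2
  set l := Real.log (1 + cL * Real.log n / ν) with hldef
  have hnν : (n : ℝ) * ν = r * α * s * Real.log n := by
    rw [hνdef]; field_simp
  -- As $n\nu=r\alpha s\log n$, the term $6000r\alpha$ of the threshold cancels the moments of the
  -- $n$ blocks exactly. The rest leaves $(K+3)\,s\,l$, matched to the union bound.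
  have heq : -(l / (16 * (cL * Real.log n))) *
        ((6000 * r * α + 16 * cL * (K + 3)) * (s * Real.log n)) +
      n * (6000 * (l / (16 * (cL * Real.log n))) * ν)
      = -((K + 3) * (s * l)) := by
    have : n * (6000 * (l / (16 * (cL * Real.log n))) * ν)
        = 6000 * (l / (16 * (cL * Real.log n))) * (n * ν) := by ring
    rw [this, hnν]
    field_simp
    ring
  rw [heq]
  have : (K + 3) * (s * (1 + Real.log (n / s))) ≤ (K + 3) * (s * l) := by gcongr
  linarith

/-- The noise is bounded by `√(log n)` times the distance, uniformly over all labellings. -/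
lemma IsHSBM.measure_noise_gt_le (hA : IsHSBM μ p q (labelMatrix g) A) (hα : 0 < α)
    (hr : 1 ≤ r) (hK : 1 ≤ K) (hn : 3 ≤ n)
    (hnα : 1 + (32 + 4 * α + 3 * r * α) / (r * α) ≤ n)
    (hp : (p : ℝ) = α * Real.log n / (n : ℝ) ^ r) (hqp : (q : ℝ) ≤ p) :
    μ.real {ω | ∃ (h : Fin n → Fin K) (k : Fin K) (π : Equiv.Perm (Fin (r + 1))),
      (6000 * r * α + 16 * (32 + 4 * α + 3 * r * α) * (K + 3)) *
        (((Finset.univ.filter fun i => h i ≠ g i).card : ℝ) * Real.log n) <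
      ∑ i, noiseSum (A ω) p q g h k π i ^ 2} ≤ (K + 2) * ((r + 1)! : ℝ) / (n : ℝ) ^ 2 := by
  have hn3 : (3 : ℝ) ≤ n := by exact_mod_cast hn
  have hn0 : (0 : ℝ) < n := by linarith
  have hlog : 0 < Real.log n := Real.log_pos (by linarith)
  have hr1 : (1 : ℝ) ≤ r := by exact_mod_cast hr
  set B : ℝ := 6000 * r * α + 16 * (32 + 4 * α + 3 * r * α) * (K + 3) with hB
  set cL : ℝ := 32 + 4 * α + 3 * r * α with hcL
  set E₀ : Set Ω := {ω | ¬ ∀ e : Fin (r + 1) ↪o Fin n, A ω e = 0 ∨ A ω e = 1} with hE₀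
  set E₁ : Equiv.Perm (Fin (r + 1)) × Fin n → Set Ω := fun x =>
    {ω | (6 + 2 * α) * Real.log n ≤
      |∑ e ∈ edgesAt x.1 x.2, (1 : ℝ) * (A ω e - edgeProb p q g e)|} with hE₁
  set E₂ : (Fin n → Fin K) → Fin K × Equiv.Perm (Fin (r + 1)) → Set Ω := fun h x =>
    {ω | B * (((Finset.univ.filter fun i => h i ≠ g i).card : ℝ) * Real.log n) ≤
      ∑ i, if |noiseSum (A ω) p q g h x.1 x.2 i| ≤ cL * Real.log n
        then noiseSum (A ω) p q g h x.1 x.2 i ^ 2 else 0} with hE₂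
  have hE₀0 : μ.real E₀ = 0 := by
    have : ∀ᵐ ω ∂μ, ∀ e : Fin (r + 1) ↪o Fin n, A ω e = 0 ∨ A ω e = 1 :=
      ae_all_iff.2 fun e => ae_eq_zero_or_one_of_map_bernoulli (hA.measurable_edge e) (hA.map_edge e)
    rw [measureReal_def, ae_iff.1 this, ENNReal.toReal_zero]
  have hsub : {ω | ∃ (h : Fin n → Fin K) (k : Fin K) (π : Equiv.Perm (Fin (r + 1))),
      B * (((Finset.univ.filter fun i => h i ≠ g i).card : ℝ) * Real.log n) <
      ∑ i, noiseSum (A ω) p q g h k π i ^ 2} ⊆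
      E₀ ∪ ((⋃ x ∈ (Finset.univ : Finset (Equiv.Perm (Fin (r + 1)) × Fin n)), E₁ x) ∪
        ⋃ h ∈ Finset.univ.filter (fun h : Fin n → Fin K => h ≠ g),
          ⋃ x ∈ (Finset.univ : Finset (Fin K × Equiv.Perm (Fin (r + 1)))), E₂ h x) := by
    rintro ω ⟨h, k, π, hlt⟩
    by_contra hω
    simp only [Set.mem_union, not_or, Set.mem_iUnion, not_exists] at hω
    obtain ⟨h0, h1, h2⟩ := hω
    have h01 : ∀ e : Fin (r + 1) ↪o Fin n, A ω e = 0 ∨ A ω e = 1 := by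
      by_contra hc
      exact h0 hc
    have hdeg : ∀ i, |∑ e ∈ edgesAt π i, (1 : ℝ) * (A ω e - edgeProb p q g e)|
        < (6 + 2 * α) * Real.log n := fun i => not_le.1 (h1 (π, i) (Finset.mem_univ _))
    -- Block sums are dominated by degree plus mean, hence by $(6+4\alpha)\log n$. The truncation is
    -- therefore inactive outside the exceptional events, for every `h` at once.
    have hbd : ∀ i, |noiseSum (A ω) p q g h k π i| ≤ cL * Real.log n := by
      intro i
      have hP := sum_edgeProb_le hqp g π i
      have hpn : (p : ℝ) * n ^ r = α * Real.log n := by rw [hp]; field_simp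
      rw [hpn] at hP
      have h3 : |noiseSum (A ω) p q g h k π i|
          ≤ ∑ e ∈ edgesAt π i, (A ω e + edgeProb p q g e) := by
        refine (Finset.abs_sum_le_sum_abs _ _).trans (Finset.sum_le_sum fun e _ => ?_)
        rw [abs_mul]
        have hw : |weightDiff g h k π e| ≤ 1 := by
          rcases weightDiff_eq g h k π e with h | h | h <;> rw [h] <;> simp
        have hA0 : 0 ≤ A ω e := by rcases h01 e with h | h <;> norm_num [h]
        have hP0 := (edgeProb p q g e).2.1
        refine (mul_le_of_le_one_left (abs_nonneg _) hw).trans ?_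
        rw [abs_le]
        constructor <;> linarith
      have h4 : ∑ e ∈ edgesAt π i, (A ω e + edgeProb p q g e)
          = ∑ e ∈ edgesAt π i, (1 : ℝ) * (A ω e - edgeProb p q g e)
            + 2 * ∑ e ∈ edgesAt π i, (edgeProb p q g e : ℝ) := by
        rw [Finset.mul_sum, ← Finset.sum_add_distrib]
        exact Finset.sum_congr rfl fun e _ => by ring
      have h5 := (abs_lt.1 (hdeg i)).2
      have h6 : 0 ≤ 3 * r * α * Real.log n := by positivity
      rw [h4] at h3
      have h7 : cL * Real.log n = 32 * Real.log n + 4 * α * Real.log n + 3 * r * α * Real.log n := by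
        rw [hcL]; ring
      nlinarith
    -- At $h=g$ both sides vanish, so the union bound only runs over $h\ne g$.
    by_cases hhg : h = g
    · have hz : ∀ i, noiseSum (A ω) p q g h k π i = 0 := by
        intro i
        simp [noiseSum, weightDiff, hhg]
      simp only [hz] at hlt
      simp [hhg] at hlt
    · refine h2 h (by simpa using hhg) (k, π) (Finset.mem_univ _) ?_
      simp only [hE₂]
      refine le_trans hlt.le (le_of_eq (Finset.sum_congr rfl fun i _ => ?_))
      rw [if_pos (hbd i)]
  have hU₁ : μ.real (⋃ x ∈ (Finset.univ : Finset (Equiv.Perm (Fin (r + 1)) × Fin n)), E₁ x)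
      ≤ 2 * ((r + 1)! : ℝ) / (n : ℝ) ^ 2 := by
    refine (measureReal_biUnion_finset_le _ _).trans ((Finset.sum_le_sum fun x _ =>
      hA.measure_degree_ge_le hα hn hp hqp x.1 x.2).trans (le_of_eq ?_))
    rw [Finset.sum_const, Finset.card_univ, Fintype.card_prod, Fintype.card_perm, Fintype.card_fin,
      Fintype.card_fin, nsmul_eq_mul]
    push_cast
    field_simp
  have hU₂ : μ.real (⋃ h ∈ Finset.univ.filter (fun h : Fin n → Fin K => h ≠ g),
          ⋃ x ∈ (Finset.univ : Finset (Fin K × Equiv.Perm (Fin (r + 1)))), E₂ h x)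
      ≤ K * ((r + 1)! : ℝ) / (n : ℝ) ^ 2 := by
    have hone : ∀ h ∈ Finset.univ.filter (fun h : Fin n → Fin K => h ≠ g),
        μ.real (⋃ x ∈ (Finset.univ : Finset (Fin K × Equiv.Perm (Fin (r + 1)))), E₂ h x) ≤
        K * ((r + 1)! : ℝ) *
          Real.exp (-((K + 3) * (((Finset.univ.filter fun i => h i ≠ g i).card : ℝ) *
        (1 + Real.log (n / ((Finset.univ.filter fun i => h i ≠ g i).card : ℝ)))))) := by
      intro h hh
      refine (measureReal_biUnion_finset_le _ _).trans ((Finset.sum_le_sum fun x _ =>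
        hA.measure_truncated_noise_ge_le hα hr hn hnα hp hqp (Finset.mem_filter.1 hh).2
          x.1 x.2).trans (le_of_eq ?_))
      rw [Finset.sum_const, Finset.card_univ, Fintype.card_prod, Fintype.card_perm,
        Fintype.card_fin, Fintype.card_fin, nsmul_eq_mul]
      push_cast
      ring
    refine (measureReal_biUnion_finset_le _ _).trans ((Finset.sum_le_sum hone).trans ?_)
    rw [← Finset.mul_sum, div_eq_mul_one_div]
    exact mul_le_mul_of_nonneg_left (sum_exp_hamming_le hK (by omega) g) (by positivity)
  calc _ ≤ _ := measureReal_mono hsub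
    _ ≤ _ := measureReal_union_le _ _
    _ ≤ 0 + _ := add_le_add hE₀0.le (measureReal_union_le _ _)
    _ ≤ 0 + (2 * ((r + 1)! : ℝ) / (n : ℝ) ^ 2 + K * ((r + 1)! : ℝ) / (n : ℝ) ^ 2) := by gcongr
    _ = _ := by ring

end Events

/-! ### The mean tensor and its variation. -/

open Classical in
/-- The mean of the adjacency tensor. -/
noncomputable def meanTensor (p q : unitInterval) (g : Fin n → Fin K) : Tensor (r + 1) n :=
  fun j => if Function.Injective j then (edgeProb p q g j : ℝ) else 0

lemma edgeProb_comp_perm (p q : unitInterval) (g : Fin n → Fin K)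
    (σ : Equiv.Perm (Fin (r + 1))) (j : Fin (r + 1) → Fin n) :
    edgeProb p q g (j ∘ σ) = edgeProb p q g j := by
  have : (∀ t, g ((j ∘ σ) t) = g ((j ∘ σ) 0)) ↔ ∀ t, g (j t) = g (j 0) := by
    constructor
    · intro h t
      have h1 := h (σ.symm t)
      have h2 := h (σ.symm 0)
      simp only [Function.comp_apply, Equiv.apply_symm_apply] at h1 h2
      rw [h1, ← h2]
    · intro h t
      simp only [Function.comp_apply]
      rw [h, h (σ 0)]
  simp only [edgeProb, this]

lemma meanTensor_symm (p q : unitInterval) (g : Fin n → Fin K)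
    (σ : Equiv.Perm (Fin (r + 1))) (j : Fin (r + 1) → Fin n) :
    meanTensor p q g (j ∘ σ) = meanTensor p q g j := by
  simp only [meanTensor, edgeProb_comp_perm, σ.injective_comp]

lemma meanTensor_diag (p q : unitInterval) (g : Fin n → Fin K)
    (j : Fin (r + 1) → Fin n) (hj : ¬ Function.Injective j) : meanTensor p q g j = 0 := by
  simp [meanTensor, hj]

lemma tensorApply_sub_eq {a : Tensor (r + 1) n}
    (hsymm : ∀ (σ : Equiv.Perm (Fin (r + 1))) (i : Fin (r + 1) → Fin n), a (i ∘ σ) = a i)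
    (hdiag : ∀ i : Fin (r + 1) → Fin n, ¬ Function.Injective i → a i = 0)
    (p q : unitInterval) (g h : Fin n → Fin K) (i : Fin n) (k : Fin K) :
    tensorApply a (labelMatrix h) i k - tensorApply a (labelMatrix g) i k
      = ∑ π, noiseSum a p q g h k π i +
        (tensorApply (meanTensor (r := r) p q g) (labelMatrix h) i k -
          tensorApply (meanTensor (r := r) p q g) (labelMatrix g) i k) := by
  have hmean : ∀ e : Fin (r + 1) ↪o Fin n, meanTensor p q g e = edgeProb p q g e := fun e => by
    simp [meanTensor, e.injective]
  rw [tensorApply_eq_sum_perm hsymm hdiag, tensorApply_eq_sum_perm hsymm hdiag,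
    tensorApply_eq_sum_perm (meanTensor_symm p q g) (meanTensor_diag p q g),
    tensorApply_eq_sum_perm (meanTensor_symm p q g) (meanTensor_diag p q g)]
  simp only [← Finset.sum_sub_distrib, ← Finset.sum_add_distrib]
  refine Finset.sum_congr rfl fun π _ => ?_
  rw [noiseSum, edgesAt, Finset.sum_filter, ← Finset.sum_add_distrib]
  refine Finset.sum_congr rfl fun e _ => ?_
  rw [hmean, weightDiff]
  split_ifs <;> ring

/-- The vertices of community `a` whose membership in column `k` changes from `g` to `h`. -/
def changed (g h : Fin n → Fin K) (a k : Fin K) : Finset (Fin n) :=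
  Finset.univ.filter fun v => g v = a ∧ ¬ (h v = k ↔ a = k)

/-- A relabelled vertex leaves one column and enters another, so it is counted twice. -/
lemma sum_card_changed (g h : Fin n → Fin K) :
    ∑ a, ∑ k, (changed g h a k).card = 2 * (Finset.univ.filter fun i => h i ≠ g i).card := by
  simp only [changed, Finset.card_filter, Finset.mul_sum]
  have : ∀ a, ∑ k, ∑ v, (if g v = a ∧ ¬ (h v = k ↔ a = k) then 1 else 0)
      = ∑ v, ∑ k, (if g v = a ∧ ¬ (h v = k ↔ a = k) then 1 else 0) := fun a => Finset.sum_comm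
  simp only [this]
  rw [Finset.sum_comm]
  refine Finset.sum_congr rfl fun v _ => ?_
  rw [Finset.sum_eq_single (g v)]
  · by_cases hv : h v = g v
    · simp [hv]
    · rw [Finset.sum_congr rfl (g := fun k => (if h v = k then 1 else 0) + if g v = k then 1 else 0)]
      · rw [Finset.sum_add_distrib]
        simp [hv]
      · intro k _
        by_cases h1 : h v = k
        · have : ¬ g v = k := fun h2 => hv (h1.trans h2.symm)
          simp [h1, this]
        · by_cases h2 : g v = k <;> simp [h1, h2]
  · intro a _ ha
    simp [ha.symm]
  · simp

/-- The entries depend on `i` only through its community, giving the factor `m`, and a sum of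
squares is at most the square of the sum. Thus the dominant mean term is quadratic in the Frobenius
distance. -/
lemma sum_sq_card_changed_le {g : Fin n → Fin K} {m : ℕ}
    (hg : ∀ k, (Finset.univ.filter fun i => g i = k).card = m) (h : Fin n → Fin K) :
    ∑ i, ∑ k, ((changed g h (g i) k).card : ℝ) ^ 2
      ≤ m * (2 * ((Finset.univ.filter fun i => h i ≠ g i).card : ℝ)) ^ 2 := by
  rw [← Finset.sum_fiberwise Finset.univ g]
  have h1 : ∀ a, ∑ i ∈ Finset.univ.filter (fun i => g i = a),
      ∑ k, ((changed g h (g i) k).card : ℝ) ^ 2 = m * ∑ k, ((changed g h a k).card : ℝ) ^ 2 := by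
    intro a
    rw [← hg a, ← nsmul_eq_mul, ← Finset.sum_const]
    exact Finset.sum_congr rfl fun i hi => by rw [(Finset.mem_filter.1 hi).2]
  simp only [h1]
  rw [← Finset.mul_sum]
  refine mul_le_mul_of_nonneg_left ?_ (Nat.cast_nonneg m)
  have h2 : (2 * ((Finset.univ.filter fun i => h i ≠ g i).card : ℝ))
      = ∑ a, ∑ k, ((changed g h a k).card : ℝ) := by
    exact_mod_cast (sum_card_changed g h).symm
  rw [h2]
  simp only [← Finset.sum_product']
  exact Finset.sum_sq_le_sq_sum_of_nonneg fun _ _ => Nat.cast_nonneg _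

/-- Changing one element changes the number of injective tuples by lower order. -/
lemma abs_descFactorial_sub_le (m r : ℕ) :
    |((m - 1).descFactorial r : ℝ) - (m.descFactorial r : ℝ)| ≤ r * (m : ℝ) ^ (r - 1) := by
  rcases Nat.eq_zero_or_pos m with rfl | hm
  · simp only [Nat.zero_sub, sub_self, abs_zero]
    positivity
  obtain ⟨m', rfl⟩ : ∃ m', m = m' + 1 := ⟨m - 1, by omega⟩
  cases r with
  | zero => simp
  | succ r =>
    rw [Nat.add_sub_cancel, Nat.add_sub_cancel]
    have h1 : (m' + 1).descFactorial (r + 1) = (m' + 1) * m'.descFactorial r :=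
      Nat.succ_descFactorial_succ m' r
    have h2 : m'.descFactorial (r + 1) = (m' - r) * m'.descFactorial r := Nat.descFactorial_succ m' r
    rw [h1, h2, abs_sub_comm, abs_of_nonneg]
    · have h3 : (m'.descFactorial r : ℝ) ≤ ((m' + 1 : ℕ) : ℝ) ^ r := by
        exact_mod_cast (Nat.descFactorial_le_pow m' r).trans (Nat.pow_le_pow_left (by omega) r)
      -- Also valid when the natural subtraction truncates, since then $m'+1\le r+1$.
      have h4 : (m' : ℝ) + 1 - ((m' - r : ℕ) : ℝ) ≤ (r + 1 : ℕ) := by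
        have : m' + 1 ≤ (m' - r) + (r + 1) := by omega
        have : ((m' + 1 : ℕ) : ℝ) ≤ (((m' - r) + (r + 1) : ℕ) : ℝ) := by exact_mod_cast this
        push_cast at this ⊢
        linarith
      calc _ = ((m' : ℝ) + 1 - ((m' - r : ℕ) : ℝ)) * (m'.descFactorial r : ℝ) := by
            push_cast
            ring
        _ ≤ ((r + 1 : ℕ) : ℝ) * ((m' + 1 : ℕ) : ℝ) ^ r :=
            mul_le_mul h4 h3 (Nat.cast_nonneg _) (Nat.cast_nonneg _)
    · rw [sub_nonneg]
      exact_mod_cast Nat.mul_le_mul_right _ (by omega)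

open Classical in
lemma sum_injective_prod_labelMatrix (h : Fin n → Fin K) (i : Fin n) (k : Fin K) :
    ∑ j : Fin r → Fin n, (if Function.Injective (Fin.cons i j : Fin (r + 1) → Fin n)
      then (1 : ℝ) else 0) * ∏ t, labelMatrix h (j t) k
      = (((Finset.univ.filter fun v => h v = k).erase i).card.descFactorial r : ℝ) := by
  rw [← card_injective_cons i, Finset.card_filter, Nat.cast_sum]
  refine Finset.sum_congr rfl fun j _ => ?_
  rw [prod_labelMatrix_eq]
  by_cases h1 : Function.Injective (Fin.cons i j : Fin (r + 1) → Fin n) <;>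
    by_cases h2 : ∀ t, h (j t) = k <;> simp [h1, h2]

/-- The change of the mean is of first order in the number of changed vertices. -/
lemma abs_tensorApply_meanTensor_sub_le {p q : unitInterval} (hqp : (q : ℝ) ≤ p)
    {g h : Fin n → Fin K} {m : ℕ} (hg : ∀ k, (Finset.univ.filter fun i => g i = k).card = m)
    (hh : ∀ k, (Finset.univ.filter fun i => h i = k).card = m) (i : Fin n) (k : Fin K) :
    |tensorApply (meanTensor (r := r) p q g) (labelMatrix h) i k -
        tensorApply (meanTensor (r := r) p q g) (labelMatrix g) i k|
      ≤ (p - q) * (r * (m : ℝ) ^ (r - 1)) * (changed g h (g i) k).card +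
        q * (r * (m : ℝ) ^ (r - 1)) * |labelMatrix h i k - labelMatrix g i k| := by
  classical
  -- The mean is `q` on all injective tuples plus `p - q` on those inside the community of `i`.
  have hsplit : ∀ j : Fin r → Fin n, meanTensor p q g (Fin.cons i j : Fin (r + 1) → Fin n) =
      q * (if Function.Injective (Fin.cons i j : Fin (r + 1) → Fin n) then (1 : ℝ) else 0) +
      (p - q) * (if Function.Injective (Fin.cons i j : Fin (r + 1) → Fin n) ∧ ∀ t, g (j t) = g i
        then (1 : ℝ) else 0) := by
    intro j
    have : (∀ t : Fin (r + 1), g ((Fin.cons i j : Fin (r + 1) → Fin n) t)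
        = g ((Fin.cons i j : Fin (r + 1) → Fin n) 0)) ↔ ∀ t, g (j t) = g i := by
      simp [Fin.forall_fin_succ]
    simp only [meanTensor, edgeProb, this]
    by_cases h1 : Function.Injective (Fin.cons i j : Fin (r + 1) → Fin n) <;>
      by_cases h2 : ∀ t, g (j t) = g i <;> simp [h1, h2]
  have hdiff : tensorApply (meanTensor (r := r) p q g) (labelMatrix h) i k -
        tensorApply (meanTensor (r := r) p q g) (labelMatrix g) i k
      = (p - q) * (∑ j : Fin r → Fin n,
        (if Function.Injective (Fin.cons i j : Fin (r + 1) → Fin n) ∧ ∀ t, g (j t) = g i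
        then (1 : ℝ) else 0) * (∏ t, labelMatrix h (j t) k - ∏ t, labelMatrix g (j t) k)) +
        q * ((((Finset.univ.filter fun v => h v = k).erase i).card.descFactorial r : ℝ)
          - (((Finset.univ.filter fun v => g v = k).erase i).card.descFactorial r : ℝ)) := by
    rw [tensorApply_succ, tensorApply_succ, ← sum_injective_prod_labelMatrix,
      ← sum_injective_prod_labelMatrix, ← Finset.sum_sub_distrib, ← Finset.sum_sub_distrib,
      Finset.mul_sum, Finset.mul_sum, ← Finset.sum_add_distrib]
    refine Finset.sum_congr rfl fun j _ => ?_
    rw [hsplit]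
    ring
  have hpq : 0 ≤ (p : ℝ) - q := by linarith
  have hq0 := q.2.1
  rw [hdiff]
  refine (abs_add_le _ _).trans (add_le_add ?_ ?_)
  · rw [abs_mul, abs_of_nonneg hpq, mul_assoc]
    refine mul_le_mul_of_nonneg_left ?_ hpq
    have hcount := card_piFinset_exists_mem_le r (Finset.univ.filter fun v => g v = g i)
      (changed g h (g i) k)
    rw [hg] at hcount
    have hcount' : ((((Fintype.piFinset fun _ : Fin r => Finset.univ.filter fun v => g v = g i).filter
        fun j => ∃ t, j t ∈ changed g h (g i) k).card : ℕ) : ℝ)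
        ≤ r * (m : ℝ) ^ (r - 1) * (changed g h (g i) k).card := by
      rw [mul_assoc]
      exact_mod_cast hcount
    refine le_trans ?_ hcount'
    rw [← Finset.sum_boole]
    refine (Finset.abs_sum_le_sum_abs _ _).trans ?_
    rw [← Finset.sum_subset (Finset.subset_univ
      (Fintype.piFinset fun _ : Fin r => Finset.univ.filter fun v => g v = g i))]
    · refine Finset.sum_le_sum fun j hj => ?_
      rw [Fintype.mem_piFinset] at hj
      have hj' : ∀ t, g (j t) = g i := fun t => (Finset.mem_filter.1 (hj t)).2
      rw [prod_labelMatrix_eq, prod_labelMatrix_eq]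
      by_cases hex : ∃ t, j t ∈ changed g h (g i) k
      · rw [if_pos hex, abs_mul]
        refine mul_le_one₀ ?_ (abs_nonneg _) ?_
        · split_ifs <;> simp
        · split_ifs <;> simp
      · have : (∀ t, h (j t) = k) ↔ ∀ t, g (j t) = k := by
          refine forall_congr' fun t => ?_
          by_contra hc
          refine hex ⟨t, ?_⟩
          rw [changed, Finset.mem_filter]
          refine ⟨Finset.mem_univ _, hj' t, ?_⟩
          rwa [hj' t] at hc
        rw [if_neg hex]
        simp [this]
    · intro j _ hj
      have hne : ¬ ∀ t, g (j t) = g i := fun hc =>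
        hj (Fintype.mem_piFinset.2 fun t => Finset.mem_filter.2 ⟨Finset.mem_univ _, hc t⟩)
      rw [if_neg fun hc => hne hc.2]
      simp
  · rw [abs_mul, abs_of_nonneg hq0, mul_assoc]
    refine mul_le_mul_of_nonneg_left ?_ hq0
    -- By balance, the count behind the `q` part depends on the labels only through whether `i`
    -- itself lies in column `k`. It therefore changes only where the entry of the label matrix
    -- changes.
    have hcard : ∀ f : Fin n → Fin K, (∀ k, (Finset.univ.filter fun i => f i = k).card = m) →
        ((Finset.univ.filter fun v => f v = k).erase i).card = if f i = k then m - 1 else m := by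
      intro f hf
      rw [Finset.card_erase_eq_ite, hf]
      simp
    rw [hcard h hh, hcard g hg, labelMatrix_apply, labelMatrix_apply]
    have hd := abs_descFactorial_sub_le m r
    by_cases h1 : h i = k <;> by_cases h2 : g i = k
    · simp [h1, h2]
    · simpa [h1, h2] using hd
    · rw [abs_sub_comm] at hd
      simpa [h1, h2] using hd
    · simp [h1, h2]

/-! ### Variation of the whole tensor power. -/

/-- Deterministic bound on the change of the tensor power, given a bound on the noise. -/
lemma norm_tensorApply_sub_le {a : Tensor (r + 1) n}
    (hsymm : ∀ (σ : Equiv.Perm (Fin (r + 1))) (i : Fin (r + 1) → Fin n), a (i ∘ σ) = a i)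
    (hdiag : ∀ i : Fin (r + 1) → Fin n, ¬ Function.Injective i → a i = 0)
    {p q : unitInterval} (hqp : (q : ℝ) ≤ p) {g h : Fin n → Fin K} {m : ℕ}
    (hg : ∀ k, (Finset.univ.filter fun i => g i = k).card = m)
    (hh : ∀ k, (Finset.univ.filter fun i => h i = k).card = m) {b : ℝ} (hb : 0 ≤ b)
    (hnoise : ∀ k (π : Equiv.Perm (Fin (r + 1))), ∑ i, noiseSum a p q g h k π i ^ 2
      ≤ b * ((Finset.univ.filter fun i => h i ≠ g i).card : ℝ)) :
    ‖tensorApply a (labelMatrix h) - tensorApply a (labelMatrix g)‖ ≤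
      (r + 1)! * √(K * b) * ‖labelMatrix h - labelMatrix g‖ +
      (p - q) * (r * (m : ℝ) ^ (r - 1)) * √m * ‖labelMatrix h - labelMatrix g‖ ^ 2 +
      q * (r * (m : ℝ) ^ (r - 1)) * ‖labelMatrix h - labelMatrix g‖ := by
  set x := ‖labelMatrix h - labelMatrix g‖ with hx
  have hx0 : 0 ≤ x := norm_nonneg _
  have hx2 := frobenius_norm_sq_labelMatrix_sub h g
  rw [← hx] at hx2
  set s : ℝ := ((Finset.univ.filter fun i => h i ≠ g i).card : ℝ) with hs
  have hpq : 0 ≤ (p : ℝ) - q := by linarith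
  have hq0 := q.2.1
  have hnorm_le : ∀ {M : Matrix (Fin n) (Fin K) ℝ} {c : ℝ}, 0 ≤ c →
      (∑ i, ∑ k, M i k ^ 2 ≤ c ^ 2) → ‖M‖ ≤ c := by
    intro M c hc hM
    rw [← frobenius_norm_sq] at hM
    exact le_of_sq_le_sq hM hc
  set N : Matrix (Fin n) (Fin K) ℝ := Matrix.of fun i k =>
    ∑ π : Equiv.Perm (Fin (r + 1)), noiseSum a p q g h k π i with hN
  set U : Matrix (Fin n) (Fin K) ℝ := Matrix.of fun i k =>
    (p - q) * (r * (m : ℝ) ^ (r - 1)) * (changed g h (g i) k).card with hU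
  set V : Matrix (Fin n) (Fin K) ℝ := Matrix.of fun i k =>
    q * (r * (m : ℝ) ^ (r - 1)) * |labelMatrix h i k - labelMatrix g i k| with hV
  -- Different orderings reuse the same hyperedges and are dependent; Cauchy–Schwarz over the
  -- $(r+1)!$ orderings needs no independence between them.
  have hNn : ‖N‖ ≤ (r + 1)! * √(K * b) * x := by
    refine hnorm_le (by positivity) ?_
    calc ∑ i, ∑ k, N i k ^ 2 ≤ ∑ i, ∑ k, ((r + 1)! : ℝ) *
          ∑ π : Equiv.Perm (Fin (r + 1)), noiseSum a p q g h k π i ^ 2 := by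
          refine Finset.sum_le_sum fun i _ => Finset.sum_le_sum fun k _ => ?_
          have := sq_sum_le_card_mul_sum_sq (s := (Finset.univ : Finset (Equiv.Perm (Fin (r + 1)))))
            (f := fun π => noiseSum a p q g h k π i)
          rwa [Finset.card_univ, Fintype.card_perm, Fintype.card_fin] at this
      _ = ((r + 1)! : ℝ) * ∑ k : Fin K, ∑ π : Equiv.Perm (Fin (r + 1)),
          ∑ i, noiseSum a p q g h k π i ^ 2 := by
          simp only [← Finset.mul_sum]
          rw [Finset.sum_comm]
          congr 1
          exact Finset.sum_congr rfl fun k _ => Finset.sum_comm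
      _ ≤ ((r + 1)! : ℝ) * ∑ k : Fin K, ∑ π : Equiv.Perm (Fin (r + 1)), b * s := by
          gcongr with k _ π _
          exact hnoise k π
      _ = ((r + 1)! : ℝ) ^ 2 * (K * b) * s := by
          simp only [Finset.sum_const, Finset.card_univ, Fintype.card_perm, Fintype.card_fin,
            nsmul_eq_mul]
          ring
      _ ≤ ((r + 1)! : ℝ) ^ 2 * (K * b) * x ^ 2 := by
          gcongr
          have : 0 ≤ s := Nat.cast_nonneg _
          linarith
      _ = _ := by
          rw [mul_pow, mul_pow, Real.sq_sqrt (by positivity)]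
  have hUn : ‖U‖ ≤ (p - q) * (r * (m : ℝ) ^ (r - 1)) * √m * x ^ 2 := by
    refine hnorm_le (by positivity) ?_
    have h1 := sum_sq_card_changed_le hg h
    rw [← hs, ← hx2] at h1
    calc ∑ i, ∑ k, U i k ^ 2 = ((p - q) * (r * (m : ℝ) ^ (r - 1))) ^ 2 *
          ∑ i, ∑ k, ((changed g h (g i) k).card : ℝ) ^ 2 := by
          simp only [hU, Matrix.of_apply, mul_pow, Finset.mul_sum]
      _ ≤ ((p - q) * (r * (m : ℝ) ^ (r - 1))) ^ 2 * (m * (x ^ 2) ^ 2) := by gcongr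
      _ = _ := by
          rw [mul_pow _ (x ^ 2), mul_pow _ (√m), Real.sq_sqrt (Nat.cast_nonneg m)]
          ring
  have hVn : ‖V‖ ≤ q * (r * (m : ℝ) ^ (r - 1)) * x := by
    refine hnorm_le (by positivity) (le_of_eq ?_)
    rw [mul_pow _ x, hx, frobenius_norm_sq]
    simp only [hV, Matrix.of_apply, mul_pow, sq_abs, Finset.mul_sum, Matrix.sub_apply]
  have hsum : ‖tensorApply a (labelMatrix h) - tensorApply a (labelMatrix g) - N‖ ≤ ‖U + V‖ := by
    refine hnorm_le (norm_nonneg _) ?_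
    rw [frobenius_norm_sq]
    refine Finset.sum_le_sum fun i _ => Finset.sum_le_sum fun k _ => ?_
    rw [← sq_abs]
    refine pow_le_pow_left₀ (abs_nonneg _) ?_ 2
    simp only [Matrix.sub_apply, Matrix.add_apply]
    rw [tensorApply_sub_eq hsymm hdiag p q g h i k, hN, Matrix.of_apply, add_sub_cancel_left]
    exact abs_tensorApply_meanTensor_sub_le hqp hg hh i k
  calc ‖tensorApply a (labelMatrix h) - tensorApply a (labelMatrix g)‖
      = ‖N + (tensorApply a (labelMatrix h) - tensorApply a (labelMatrix g) - N)‖ := by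
        rw [add_sub_cancel]
    _ ≤ ‖N‖ + (‖U‖ + ‖V‖) := (norm_add_le _ _).trans
        (add_le_add le_rfl (hsum.trans (norm_add_le _ _)))
    _ ≤ _ := by linarith

/-! ### Separation of the planted entries. -/

/-- The total weight of the edge `e` in the entry `(i, k)` of the tensor power. -/
noncomputable def edgeWeight (g : Fin n → Fin K) (i : Fin n) (k : Fin K)
    (e : Fin (r + 1) ↪o Fin n) : ℝ :=
  ∑ π : Equiv.Perm (Fin (r + 1)),
    if e (π 0) = i then ∏ t : Fin r, labelMatrix g (e (π t.succ)) k else 0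

lemma tensorApply_eq_sum_edgeWeight {a : Tensor (r + 1) n}
    (hsymm : ∀ (σ : Equiv.Perm (Fin (r + 1))) (i : Fin (r + 1) → Fin n), a (i ∘ σ) = a i)
    (hdiag : ∀ i : Fin (r + 1) → Fin n, ¬ Function.Injective i → a i = 0)
    (g : Fin n → Fin K) (i : Fin n) (k : Fin K) :
    tensorApply a (labelMatrix g) i k = ∑ e : Fin (r + 1) ↪o Fin n, a e * edgeWeight g i k e := by
  rw [tensorApply_eq_sum_perm hsymm hdiag, Finset.sum_comm]
  simp only [edgeWeight, Finset.mul_sum]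

/-- Obtained by expanding the symmetric tensor that is the indicator of injective tuples. -/
lemma sum_edgeWeight (g : Fin n → Fin K) (i : Fin n) (k : Fin K) :
    ∑ e : Fin (r + 1) ↪o Fin n, edgeWeight g i k e
      = (((Finset.univ.filter fun v => g v = k).erase i).card.descFactorial r : ℝ) := by
  classical
  rw [← sum_injective_prod_labelMatrix]
  have h := tensorApply_eq_sum_edgeWeight
    (a := fun j : Fin (r + 1) → Fin n => if Function.Injective j then (1 : ℝ) else 0)
    (fun σ j => by simp only [σ.injective_comp]) (fun j hj => by simp [hj]) g i k
  rw [tensorApply_succ] at h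
  rw [h]
  exact Finset.sum_congr rfl fun e _ => by simp [e.injective]

lemma card_perm_apply_zero_eq (r : ℕ) (x : Fin (r + 1)) :
    (Finset.univ.filter fun π : Equiv.Perm (Fin (r + 1)) => π 0 = x).card = r ! := by
  rw [← Fintype.card_subtype]
  have : r ! = Fintype.card {y : Fin (r + 1) × Equiv.Perm (Fin r) // y.1 = x} := by
    have hr : r ! = (Finset.univ : Finset (Equiv.Perm (Fin r))).card := by
      rw [Finset.card_univ, Fintype.card_perm, Fintype.card_fin]
    rw [Fintype.card_subtype, hr]
    refine Finset.card_bij (fun τ _ => (x, τ)) (by simp) (by simp) ?_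
    rintro ⟨y, τ⟩ hy
    exact ⟨τ, Finset.mem_univ _, by simp [(Finset.mem_filter.1 hy).2.symm]⟩
  rw [this]
  refine Fintype.card_congr (Equiv.Perm.decomposeFin.subtypeEquiv fun π => ?_)
  obtain ⟨⟨y, τ⟩, rfl⟩ := Equiv.Perm.decomposeFin.symm.surjective π
  simp

lemma edgeWeight_nonneg (g : Fin n → Fin K) (i : Fin n) (k : Fin K)
    (e : Fin (r + 1) ↪o Fin n) : 0 ≤ edgeWeight g i k e := by
  refine Finset.sum_nonneg fun π _ => ?_
  rw [prod_labelMatrix_eq g k fun t => e (π t.succ)]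
  split_ifs <;> simp

lemma edgeWeight_le (g : Fin n → Fin K) (i : Fin n) (k : Fin K)
    (e : Fin (r + 1) ↪o Fin n) : edgeWeight g i k e ≤ r ! := by
  by_cases hi : ∃ x, e x = i
  · obtain ⟨x, hx⟩ := hi
    rw [← card_perm_apply_zero_eq r x, Finset.card_filter, Nat.cast_sum]
    refine Finset.sum_le_sum fun π _ => ?_
    rw [prod_labelMatrix_eq g k fun t => e (π t.succ)]
    have : e (π 0) = i ↔ π 0 = x := by rw [← hx, e.injective.eq_iff]
    simp only [this]
    split_ifs <;> simp
  · push Not at hi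
    rw [edgeWeight, Finset.sum_eq_zero fun π _ => if_neg (hi _)]
    exact Nat.cast_nonneg _

lemma exists_of_edgeWeight_ne_zero {g : Fin n → Fin K} {i : Fin n} {k : Fin K}
    {e : Fin (r + 1) ↪o Fin n} (h : edgeWeight g i k e ≠ 0) :
    ∃ π : Equiv.Perm (Fin (r + 1)), e (π 0) = i ∧ ∀ t : Fin r, g (e (π t.succ)) = k := by
  obtain ⟨π, -, hπ⟩ := Finset.exists_ne_zero_of_sum_ne_zero h
  rw [prod_labelMatrix_eq g k fun t => e (π t.succ)] at hπ
  refine ⟨π, ?_, ?_⟩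
  · by_contra hc
    simp [hc] at hπ
  · by_contra hc
    simp [hc] at hπ

/-- A nonzero weight puts `i` in the hyperedge and some tail vertex in community `l`; `1 ≤ r`
provides that tail vertex. -/
lemma edgeWeight_eq_zero_of_mono (hr : 1 ≤ r) {g : Fin n → Fin K} {i : Fin n} {l : Fin K}
    (hl : l ≠ g i) {e : Fin (r + 1) ↪o Fin n} (he : ∀ t, g (e t) = g (e 0)) :
    edgeWeight g i l e = 0 := by
  by_contra h
  obtain ⟨π, h0, h1⟩ := exists_of_edgeWeight_ne_zero h
  have h2 := h1 ⟨0, hr⟩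
  rw [he] at h2
  rw [← h0, he] at hl
  exact hl h2.symm

lemma edgeWeight_eq_zero_of_not_mono {g : Fin n → Fin K} {i : Fin n}
    {e : Fin (r + 1) ↪o Fin n} (he : ¬ ∀ t, g (e t) = g (e 0)) :
    edgeWeight g i (g i) e = 0 := by
  by_contra h
  obtain ⟨π, h0, h1⟩ := exists_of_edgeWeight_ne_zero h
  have h2 : ∀ t, g (e (π t)) = g i := by
    intro t
    refine Fin.cases ?_ (fun t => h1 t) t
    rw [h0]
  refine he fun t => ?_
  have h3 := h2 (π.symm t)
  have h4 := h2 (π.symm 0)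
  rw [π.apply_symm_apply] at h3 h4
  rw [h3, h4]

/-- Convexity of the exponential on `[0, D]`. -/
lemma exp_mul_sub_one_le {c x D : ℝ} (hx : 0 ≤ x) (hxD : x ≤ D) (hD : 0 < D) :
    Real.exp (c * x) - 1 ≤ x / D * (Real.exp (c * D) - 1) := by
  have h1 : 0 ≤ 1 - x / D := by
    rw [sub_nonneg, div_le_one hD]
    exact hxD
  have h := convexOn_exp.2 (Set.mem_univ (0 : ℝ)) (Set.mem_univ (c * D)) h1
    (show 0 ≤ x / D by positivity) (by ring)
  simp only [smul_eq_mul, mul_zero, zero_add, Real.exp_zero, mul_one] at h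
  rw [show x / D * (c * D) = c * x by field_simp] at h
  linarith

section Separation

variable {Ω : Type v} [MeasurableSpace Ω] {μ : Measure Ω} [IsProbabilityMeasure μ]
  {p q : unitInterval} {g : Fin n → Fin K} {A : Ω → Tensor (r + 1) n}

omit [IsProbabilityMeasure μ] in
lemma mgf_mul_le_of_map_bernoulli {X : Ω → ℝ} {p : unitInterval} (hX : Measurable X)
    (hlaw : μ.map X = bernoulliMeasure (1 : ℝ) 0 p) (c t : ℝ) :
    mgf (fun ω => X ω * c) μ t ≤ Real.exp (p * (Real.exp (t * c) - 1)) := by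
  have h1 : mgf (fun ω => X ω * c) μ t
      = p * Real.exp (t * (1 * c)) + (1 - p) * Real.exp (t * (0 * c)) :=
    integral_comp_of_map_bernoulli hX hlaw (f := fun x => Real.exp (t * (x * c))) (by fun_prop)
  rw [h1, one_mul, zero_mul, mul_zero, Real.exp_zero]
  linarith [Real.add_one_le_exp (p * (Real.exp (t * c) - 1))]

/-- Chernoff's bound for the separation of one entry. -/
lemma IsHSBM.measure_separation_le (hA : IsHSBM μ p q (labelMatrix g) A) (hr : 1 ≤ r)
    (i : Fin n) {l : Fin K} (hl : l ≠ g i) {θ : ℝ} (hθ : 0 ≤ θ) (x : ℝ) :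
    μ.real {ω | tensorApply (A ω) (labelMatrix g) i (g i)
        - tensorApply (A ω) (labelMatrix g) i l ≤ x} ≤
      Real.exp (θ * x +
        (p * ((((Finset.univ.filter fun v => g v = g i).erase i).card.descFactorial r : ℝ) / r ! *
          (Real.exp (-θ * r !) - 1)) +
        q * ((((Finset.univ.filter fun v => g v = l).erase i).card.descFactorial r : ℝ) / r ! *
          (Real.exp (θ * r !) - 1)))) := by
  have hD : (0 : ℝ) < r ! := by exact_mod_cast Nat.factorial_pos r
  set c : (Fin (r + 1) ↪o Fin n) → ℝ := fun e => edgeWeight g i (g i) e - edgeWeight g i l e with hc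
  have hX : ∀ ω, tensorApply (A ω) (labelMatrix g) i (g i) - tensorApply (A ω) (labelMatrix g) i l
      = ∑ e : Fin (r + 1) ↪o Fin n, A ω e * c e := by
    intro ω
    rw [tensorApply_eq_sum_edgeWeight (hA.symmetric ω) (hA.diagonal ω),
      tensorApply_eq_sum_edgeWeight (hA.symmetric ω) (hA.diagonal ω), ← Finset.sum_sub_distrib]
    exact Finset.sum_congr rfl fun e _ => by rw [hc]; ring
  simp only [hX]
  have hmeas : ∀ e : Fin (r + 1) ↪o Fin n, Measurable fun ω => A ω e * c e := fun e =>
    (hA.measurable_edge e).mul_const _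
  have hind : iIndepFun (fun (e : Fin (r + 1) ↪o Fin n) ω => A ω e * c e) μ :=
    hA.indep.comp (fun e y => y * c e) fun e => by fun_prop
  have hsumfun : (fun ω => ∑ e : Fin (r + 1) ↪o Fin n, A ω e * c e)
      = ∑ e : Fin (r + 1) ↪o Fin n, fun ω => A ω e * c e := by
    funext ω
    simp
  have hint : Integrable (fun ω => Real.exp (-θ * ∑ e : Fin (r + 1) ↪o Fin n, A ω e * c e)) μ := by
    refine integrable_exp_mul_of_mem_Icc (a := -∑ e : Fin (r + 1) ↪o Fin n, |c e|)
      (b := ∑ e : Fin (r + 1) ↪o Fin n, |c e|)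
      (Finset.measurable_sum _ fun e _ => hmeas e).aemeasurable ?_
    have : ∀ᵐ ω ∂μ, ∀ e : Fin (r + 1) ↪o Fin n, A ω e = 0 ∨ A ω e = 1 :=
      ae_all_iff.2 fun e => ae_eq_zero_or_one_of_map_bernoulli (hA.measurable_edge e) (hA.map_edge e)
    filter_upwards [this] with ω hω
    refine abs_le.1 ((Finset.abs_sum_le_sum_abs _ _).trans (Finset.sum_le_sum fun e _ => ?_))
    rcases hω e with h | h <;> simp [h]
  refine (measure_le_le_exp_mul_mgf x (neg_nonpos.2 hθ) hint).trans ?_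
  rw [hsumfun, hind.mgf_sum hmeas, neg_neg, Real.exp_add]
  refine mul_le_mul_of_nonneg_left ?_ (Real.exp_pos _).le
  refine (Finset.prod_le_prod (fun _ _ => mgf_nonneg) fun e _ =>
    mgf_mul_le_of_map_bernoulli (hA.measurable_edge e) (hA.map_edge e) (c e) (-θ)).trans ?_
  rw [← Real.exp_sum, Real.exp_le_exp, ← sum_edgeWeight, ← sum_edgeWeight, Finset.sum_div,
    Finset.sum_div, Finset.sum_mul, Finset.sum_mul, Finset.mul_sum, Finset.mul_sum,
    ← Finset.sum_add_distrib]
  -- Each hyperedge has a weight in at most one of the two entries. Convexity on $[0,r!]$ makes its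
  -- exponent linear in the weight, so only the total weights enter.
  refine Finset.sum_le_sum fun e _ => ?_
  by_cases he : ∀ t, g (e t) = g (e 0)
  · have h1 : edgeWeight g i l e = 0 := edgeWeight_eq_zero_of_mono hr hl he
    rw [edgeProb, if_pos he]
    simp only [hc, h1, sub_zero, zero_div, zero_mul, mul_zero, add_zero]
    exact mul_le_mul_of_nonneg_left
      (exp_mul_sub_one_le (edgeWeight_nonneg _ _ _ _) (edgeWeight_le _ _ _ _) hD) p.2.1
  · have h1 : edgeWeight g i (g i) e = 0 := edgeWeight_eq_zero_of_not_mono he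
    rw [edgeProb, if_neg he]
    simp only [hc, h1, zero_sub, zero_div, zero_mul, mul_zero, zero_add, mul_neg, neg_mul, neg_neg]
    exact mul_le_mul_of_nonneg_left
      (exp_mul_sub_one_le (edgeWeight_nonneg _ _ _ _) (edgeWeight_le _ _ _ _) hD) q.2.1

/-- The Chernoff exponent is governed by the Hellinger-type quantity `(√α - √β)²`. -/
lemma IsHSBM.measure_separation_le_rpow {α β γ : ℝ} (hβ : 0 < β) (hαβ : β < α)
    (hA : IsHSBM μ p q (labelMatrix g) A) (hr : 1 ≤ r) (hK : 1 ≤ K) (hn : 3 ≤ n)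
    (hp : (p : ℝ) = α * Real.log n / (n : ℝ) ^ r) (hq : (q : ℝ) = β * Real.log n / (n : ℝ) ^ r)
    {m : ℕ} (hm : m * K = n) (hrm : r ≤ m)
    (hg : ∀ k, (Finset.univ.filter fun i => g i = k).card = m)
    (i : Fin n) {l : Fin K} (hl : l ≠ g i) {δ : ℝ}
    (hδ : δ = (√α - √β) ^ 2 / ((K : ℝ) ^ r * (r ! : ℝ))
      - γ * Real.log (α / β) / (2 * (r ! : ℝ)) - 1)
    (hnδ : (α - √α * √β) * (r ^ 2 * K) / (r ! * (K : ℝ) ^ r) ≤ δ / 2 * n) :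
    μ.real {ω | tensorApply (A ω) (labelMatrix g) i (g i)
        - tensorApply (A ω) (labelMatrix g) i l ≤ γ * Real.log n} ≤
      (n : ℝ) ^ (-(1 + δ / 2)) := by
  have hα : 0 < α := hβ.trans hαβ
  have hn3 : (3 : ℝ) ≤ n := by exact_mod_cast hn
  have hn0 : (0 : ℝ) < n := by linarith
  have hlog : 0 < Real.log n := Real.log_pos (by linarith)
  have hD : (0 : ℝ) < r ! := by exact_mod_cast Nat.factorial_pos r
  have hK0 : (0 : ℝ) < K := by exact_mod_cast hK
  have hr0 : (0 : ℝ) < r := by exact_mod_cast hr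
  have hm0 : (0 : ℝ) < m := by exact_mod_cast lt_of_lt_of_le hr hrm
  have hmK : (m : ℝ) * K = n := by exact_mod_cast hm
  have ha : 0 < √α := Real.sqrt_pos.2 hα
  have hb : 0 < √β := Real.sqrt_pos.2 hβ
  have haa : √α ^ 2 = α := Real.sq_sqrt hα.le
  have hbb : √β ^ 2 = β := Real.sq_sqrt hβ.le
  have hab : √β ≤ √α := Real.sqrt_le_sqrt hαβ.le
  -- The tilt with $e^{\theta r!}=\sqrt{\alpha/\beta}$ turns the `p` and `q` parts into
  -- $-(\alpha-\sqrt{\alpha\beta})$ and $\sqrt{\alpha\beta}-\beta$, whose sum is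
  -- $-(\sqrt\alpha-\sqrt\beta)^2$.
  set θ : ℝ := Real.log (α / β) / (2 * r !) with hθ
  have hθ0 : 0 ≤ θ := div_nonneg (Real.log_nonneg (by rw [le_div_iff₀ hβ]; linarith)) (by positivity)
  have hexp : Real.exp (θ * r !) = √α / √β := by
    have h1 : θ * r ! = Real.log (√α / √β) := by
      rw [Real.log_div ha.ne' hb.ne', Real.log_sqrt hα.le, Real.log_sqrt hβ.le, hθ,
        Real.log_div hα.ne' hβ.ne']
      field_simp
    rw [h1, Real.exp_log (by positivity)]
  have hexp' : Real.exp (-θ * r !) = √β / √α := by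
    rw [neg_mul, Real.exp_neg, hexp, inv_div]
  refine (hA.measure_separation_le hr i hl hθ0 (γ * Real.log n)).trans ?_
  rw [Real.rpow_def_of_pos hn0, Real.exp_le_exp, hexp, hexp']
  -- The vertex `i` is removed from its own community: the falling factorial of `m - 1` is at least
  -- $(m-r)^r$, and Bernoulli's inequality applies. The loss $r^2/m$ is later paid by half of `δ`.
  have hN₁ : (m : ℝ) ^ r * (1 - r ^ 2 / m) ≤
      (((Finset.univ.filter fun v => g v = g i).erase i).card.descFactorial r : ℝ) := by
    rw [Finset.card_erase_of_mem (by simp), hg]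
    have h1 := Nat.pow_sub_le_descFactorial (m - 1) r
    rw [show m - 1 + 1 - r = m - r by omega] at h1
    have h2 : ((m : ℝ) - r) ^ r ≤ ((m - 1).descFactorial r : ℝ) := by
      rw [← Nat.cast_sub hrm]
      exact_mod_cast h1
    refine le_trans ?_ h2
    have h3 := one_add_mul_le_pow (a := -((r : ℝ) / m)) (by
      have : (r : ℝ) / m ≤ 1 := by
        rw [div_le_one hm0]; exact_mod_cast hrm
      linarith) r
    calc (m : ℝ) ^ r * (1 - r ^ 2 / m) = (m : ℝ) ^ r * (1 + r * -((r : ℝ) / m)) := by ring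
      _ ≤ (m : ℝ) ^ r * (1 + -((r : ℝ) / m)) ^ r := by gcongr
      _ = ((m : ℝ) - r) ^ r := by
        rw [← mul_pow]
        congr 1
        field_simp
        ring
  have hN₂ : (((Finset.univ.filter fun v => g v = l).erase i).card.descFactorial r : ℝ)
      ≤ (m : ℝ) ^ r := by
    rw [Finset.erase_eq_of_notMem (by simpa using hl.symm), hg]
    exact_mod_cast Nat.descFactorial_le_pow m r
  have hnr : (n : ℝ) ^ r = (m : ℝ) ^ r * (K : ℝ) ^ r := by rw [← hmK, mul_pow]
  have hpart₁ : p * ((((Finset.univ.filter fun v => g v = g i).erase i).card.descFactorial r : ℝ)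
      / r ! * (√β / √α - 1)) ≤ -((α - √α * √β) / (r ! * (K : ℝ) ^ r) * (1 - r ^ 2 * K / n))
        * Real.log n := by
    have h1 : p * ((((Finset.univ.filter fun v => g v = g i).erase i).card.descFactorial r : ℝ)
      / r ! * (√β / √α - 1)) = -((α - √α * √β) * Real.log n / ((n : ℝ) ^ r * r !)) *
        (((Finset.univ.filter fun v => g v = g i).erase i).card.descFactorial r : ℝ) := by
      have h0 : α * (√β / √α - 1) = -(α - √α * √β) := by
        rw [mul_sub, ← mul_div_assoc, mul_one, (div_eq_iff ha.ne').2
          (show α * √β = √α * √β * √α by linear_combination -√β * haa)]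
        ring
      rw [hp, neg_div', neg_mul_eq_neg_mul, ← h0]
      field_simp
    have h2 : 0 ≤ (α - √α * √β) * Real.log n / ((n : ℝ) ^ r * r !) := by
      have : 0 ≤ α - √α * √β := by
        nlinarith
      positivity
    have h3 := mul_le_mul_of_nonneg_left hN₁ h2
    rw [h1]
    have h4 : (α - √α * √β) * Real.log n / ((n : ℝ) ^ r * r !) * ((m : ℝ) ^ r * (1 - r ^ 2 / m))
        = (α - √α * √β) / (r ! * (K : ℝ) ^ r) * (1 - r ^ 2 * K / n) * Real.log n := by
      rw [hnr, ← hmK]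
      field_simp
    linarith
  have hpart₂ : q * ((((Finset.univ.filter fun v => g v = l).erase i).card.descFactorial r : ℝ)
      / r ! * (√α / √β - 1)) ≤ (√α * √β - β) / (r ! * (K : ℝ) ^ r) * Real.log n := by
    have h1 : q * ((((Finset.univ.filter fun v => g v = l).erase i).card.descFactorial r : ℝ)
      / r ! * (√α / √β - 1)) = (√α * √β - β) * Real.log n / ((n : ℝ) ^ r * r !) *
        (((Finset.univ.filter fun v => g v = l).erase i).card.descFactorial r : ℝ) := by
      have h0 : β * (√α / √β - 1) = √α * √β - β := by
        rw [mul_sub, ← mul_div_assoc, mul_one, (div_eq_iff hb.ne').2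
          (show β * √α = √α * √β * √β by linear_combination -√α * hbb)]
      rw [hq, ← h0]
      field_simp
    have h2 : 0 ≤ (√α * √β - β) * Real.log n / ((n : ℝ) ^ r * r !) := by
      have : 0 ≤ √α * √β - β := by
        nlinarith
      positivity
    rw [h1]
    refine (mul_le_mul_of_nonneg_left hN₂ h2).trans (le_of_eq ?_)
    rw [hnr]
    field_simp
  have hsq : (√α - √β) ^ 2 = (α - √α * √β) - (√α * √β - β) := by
    rw [← haa, ← hbb]
    simp only [Real.sqrt_sq ha.le, Real.sqrt_sq hb.le]
    ring
  have hcorr : (α - √α * √β) / (r ! * (K : ℝ) ^ r) * (r ^ 2 * K / n) ≤ δ / 2 := by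
    rw [div_mul_div_comm, mul_comm _ (n : ℝ), ← div_div, div_right_comm, div_le_iff₀ hn0]
    exact hnδ
  have hfinal : θ * γ + (-((α - √α * √β) / (r ! * (K : ℝ) ^ r) * (1 - r ^ 2 * K / n))
      + (√α * √β - β) / (r ! * (K : ℝ) ^ r)) ≤ -(1 + δ / 2) := by
    have h1 : (√α - √β) ^ 2 / ((K : ℝ) ^ r * (r ! : ℝ))
        = (α - √α * √β) / (r ! * (K : ℝ) ^ r) - (√α * √β - β) / (r ! * (K : ℝ) ^ r) := by
      rw [hsq, mul_comm ((K : ℝ) ^ r), sub_div]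
    have h2 : γ * Real.log (α / β) / (2 * (r ! : ℝ)) = θ * γ := by
      rw [hθ]; ring
    rw [h1, h2] at hδ
    linarith
  have := mul_le_mul_of_nonneg_right hfinal hlog.le
  linarith

end Separation

/-! ### Contraction on the good event. -/

/-- The constant in the uniform bound on the noise. -/
noncomputable def noiseConst (r K : ℕ) (α : ℝ) : ℝ :=
  6000 * r * α + 16 * (32 + 4 * α + 3 * r * α) * (K + 3)

lemma noiseConst_pos {α : ℝ} (hα : 0 < α) (r K : ℕ) : 0 < noiseConst r K α := by
  unfold noiseConst
  positivity

/-- The constant `C` of the contraction factor. -/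
noncomputable def contractionConst (r K : ℕ) (α β : ℝ) : ℝ :=
  (r + 1)! * √(K * noiseConst r K α) + β * r

/-- The planted labels are separated and the noise is small at all labellings. -/
def IsGood (a : Tensor (r + 1) n) (p q : unitInterval) (g : Fin n → Fin K) (α γ : ℝ) : Prop :=
  (∀ i l, l ≠ g i → γ * Real.log n <
    tensorApply a (labelMatrix g) i (g i) - tensorApply a (labelMatrix g) i l) ∧
  ∀ (h : Fin n → Fin K) (k : Fin K) (π : Equiv.Perm (Fin (r + 1))),
    ∑ i, noiseSum a p q g h k π i ^ 2 ≤ noiseConst r K α *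
      (((Finset.univ.filter fun i => h i ≠ g i).card : ℝ) * Real.log n)

lemma exists_community_size (hK : 1 ≤ K) {g : Fin n → Fin K}
    (hg : labelMatrix g ∈ feasible n K) :
    ∃ m : ℕ, m * K = n ∧ (m : ℝ) = n / K ∧ ∀ h : Fin n → Fin K, labelMatrix h ∈ feasible n K →
      ∀ k, (Finset.univ.filter fun i => h i = k).card = m := by
  have hK0 : (0 : ℝ) < K := by exact_mod_cast hK
  set m := (Finset.univ.filter fun i => g i = ⟨0, hK⟩).card with hm
  have hmR : (m : ℝ) = n / K := card_label hg _
  refine ⟨m, ?_, hmR, fun h hh k => ?_⟩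
  · have : (m : ℝ) * K = n := by rw [hmR]; field_simp
    exact_mod_cast this
  · have := card_label hh k
    rw [← hmR] at this
    exact_mod_cast this

lemma rpow_sub_three_halves (hr : 1 ≤ r) (hK : 1 ≤ K) :
    (K : ℝ) ^ (((r + 1 : ℕ) : ℝ) - 3 / 2) = (K : ℝ) ^ (r - 1) * √K := by
  have hK0 : (0 : ℝ) < K := by exact_mod_cast hK
  rw [Real.sqrt_eq_rpow, ← Real.rpow_natCast, ← Real.rpow_add hK0, Nat.cast_sub hr]
  congr 1
  push_cast
  ring

lemma log_div_le_sqrt_log (hn : 1 ≤ n) : Real.log n / n ≤ √(Real.log n) := by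
  have hn0 : (1 : ℝ) ≤ n := by exact_mod_cast hn
  have hlog : 0 ≤ Real.log n := Real.log_nonneg hn0
  have h1 : Real.log n ≤ n := (Real.log_le_sub_one_of_pos (by linarith)).trans (by linarith)
  rw [div_le_iff₀ (by linarith)]
  have h2 : √(Real.log n) ≤ n := by
    rw [Real.sqrt_le_left (by linarith)]
    nlinarith
  calc Real.log n = √(Real.log n) * √(Real.log n) := (Real.mul_self_sqrt hlog).symm
    _ ≤ _ := by gcongr

/-- On the good event, one projected power step contracts towards the planted labels. -/
lemma IsGood.contraction {a : Tensor (r + 1) n} {p q : unitInterval} {g : Fin n → Fin K}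
    {α β γ ε : ℝ} (hgood : IsGood a p q g α γ)
    (hsymm : ∀ (σ : Equiv.Perm (Fin (r + 1))) (i : Fin (r + 1) → Fin n), a (i ∘ σ) = a i)
    (hdiag : ∀ i : Fin (r + 1) → Fin n, ¬ Function.Injective i → a i = 0)
    (hr : 1 ≤ r) (hK : 1 ≤ K) (hn : 3 ≤ n) (hβ : 0 < β) (hαβ : β < α) (hγ : 0 < γ)
    (hp : (p : ℝ) = α * Real.log n / (n : ℝ) ^ r) (hq : (q : ℝ) = β * Real.log n / (n : ℝ) ^ r)
    (hqp : (q : ℝ) ≤ p) (hg : labelMatrix g ∈ feasible n K) (hε : 0 < ε)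
    {H : Matrix (Fin n) (Fin K) ℝ} (hH : H ∈ feasible n K)
    (hHg : ‖H - labelMatrix g‖ ≤ ε * √(n : ℝ)) {V : Matrix (Fin n) (Fin K) ℝ}
    (hV : V ∈ proj (tensorApply a H)) :
    ‖V - labelMatrix g‖ ≤
      contractionFactor n (r + 1) K α β γ (contractionConst r K α β) ε * ‖H - labelMatrix g‖ := by
  obtain ⟨h, rfl⟩ := exists_labelMatrix hH
  obtain ⟨m, -, hmR, hm⟩ := exists_community_size hK hg
  have hα : 0 < α := hβ.trans hαβ
  have hn3 : (3 : ℝ) ≤ n := by exact_mod_cast hn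
  have hn0 : (0 : ℝ) < n := by linarith
  have hlog : 0 < Real.log n := Real.log_pos (by linarith)
  have hK0 : (0 : ℝ) < K := by exact_mod_cast hK
  have hK1 : (1 : ℝ) ≤ K := by exact_mod_cast hK
  have hr0 : (0 : ℝ) < r := by exact_mod_cast hr
  have hB := noiseConst_pos hα r K
  set x := ‖labelMatrix h - labelMatrix g‖ with hx
  have hx0 : 0 ≤ x := norm_nonneg _
  have hproj := separation_mul_norm_proj_sub_le (mul_pos hγ hlog) hV hg
    fun i l hl => (hgood.1 i l hl).le
  have hdet := norm_tensorApply_sub_le hsymm hdiag hqp (hm g hg) (hm h hH)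
    (b := noiseConst r K α * Real.log n) (by positivity) (fun k π => by
      refine (hgood.2 h k π).trans (le_of_eq ?_)
      ring)
  rw [← hx] at hdet
  set w := √(Real.log n) with hw
  have hw0 : 0 < w := Real.sqrt_pos.2 hlog
  have hww : w * w = Real.log n := Real.mul_self_sqrt hlog.le
  set κ := (K : ℝ) ^ (r - 1) * √K with hκ
  have hκ0 : 0 < κ := by positivity
  have hnr : (n : ℝ) ^ r = (n : ℝ) ^ (r - 1) * n := (pow_sub_one_mul (by omega) _).symm
  have h1 : √(K * (noiseConst r K α * Real.log n)) = √(K * noiseConst r K α) * w := by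
    rw [← mul_assoc, Real.sqrt_mul (by positivity)]
  -- One of the two factors `x` is replaced by $\varepsilon\sqrt n$; this is where the initial
  -- radius enters.
  have h2 : ((p : ℝ) - q) * (r * (m : ℝ) ^ (r - 1)) * √m * x ^ 2
      ≤ r * ε * (α - β) / κ * Real.log n * x := by
    have h3 : ((p : ℝ) - q) * (r * (m : ℝ) ^ (r - 1)) * √m
        = r * (α - β) / κ * Real.log n / √n := by
      rw [hp, hq, hmR, Real.sqrt_div hn0.le, div_pow, hnr, hκ]
      have : (n : ℝ) = √n * √n := (Real.mul_self_sqrt hn0.le).symm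
      have hs : 0 < √(n : ℝ) := Real.sqrt_pos.2 hn0
      rw [div_mul_eq_div_div, div_mul_eq_div_div]
      field_simp
      rw [sq, ← this, mul_comm]
    rw [h3]
    have h4 : 0 ≤ r * (α - β) / κ * Real.log n / √n := by
      have : 0 ≤ α - β := by linarith
      positivity
    calc r * (α - β) / κ * Real.log n / √n * x ^ 2
        = r * (α - β) / κ * Real.log n / √n * (x * x) := by rw [sq]
      _ ≤ r * (α - β) / κ * Real.log n / √n * (ε * √n * x) := by gcongr
      _ = _ := by field_simp
  -- The linear mean term has size $\log n/n$ and is absorbed by the noise scale $\sqrt{\log n}$.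
  have h5 : (q : ℝ) * (r * (m : ℝ) ^ (r - 1)) * x ≤ β * r * w * x := by
    refine mul_le_mul_of_nonneg_right ?_ hx0
    have h6 : (q : ℝ) * (r * (m : ℝ) ^ (r - 1)) = β * r * (Real.log n / n) / (K : ℝ) ^ (r - 1) := by
      rw [hq, hmR, div_pow, hnr]
      field_simp
    rw [h6]
    refine (div_le_self (by positivity) (one_le_pow₀ hK1)).trans ?_
    have := log_div_le_sqrt_log (n := n) (by omega)
    gcongr
  have h7 : ‖tensorApply a (labelMatrix h) - tensorApply a (labelMatrix g)‖ ≤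
      r * ε * (α - β) / κ * Real.log n * x + contractionConst r K α β * w * x := by
    refine hdet.trans ?_
    rw [h1, contractionConst]
    linarith
  have hfac : contractionFactor n (r + 1) K α β γ (contractionConst r K α β) ε =
      4 * max (4 * r * ε * (α - β) / (γ * κ)) (contractionConst r K α β / (γ * w)) := by
    rw [contractionFactor, rpow_sub_three_halves hr hK, ← hκ, ← hw]
    push_cast
    ring_nf
  have h8 : 2 * (4 * r * ε * (α - β) / (γ * κ)) + 2 * (contractionConst r K α β / (γ * w)) ≤
      4 * max (4 * r * ε * (α - β) / (γ * κ)) (contractionConst r K α β / (γ * w)) := by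
    linarith [le_max_left (4 * r * ε * (α - β) / (γ * κ)) (contractionConst r K α β / (γ * w)),
      le_max_right (4 * r * ε * (α - β) / (γ * κ)) (contractionConst r K α β / (γ * w))]
  rw [hfac]
  have h9 : γ * Real.log n * ‖V - labelMatrix g‖ ≤ γ * Real.log n *
      ((2 * (4 * r * ε * (α - β) / (γ * κ)) + 2 * (contractionConst r K α β / (γ * w))) * x) := by
    refine hproj.trans ((mul_le_mul_of_nonneg_left h7 zero_le_two).trans ?_)
    have e1 : γ * Real.log n * ((2 * (4 * r * ε * (α - β) / (γ * κ)) +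
        2 * (contractionConst r K α β / (γ * w))) * x)
        = 8 * (r * ε * (α - β) / κ * Real.log n * x) + 2 * (contractionConst r K α β * w * x) := by
      rw [← hww]
      field_simp
      ring
    rw [e1]
    have : 0 ≤ r * ε * (α - β) / κ * Real.log n * x := by
      have : 0 ≤ α - β := by linarith
      positivity
    linarith
  refine (le_of_mul_le_mul_left h9 (by positivity)).trans ?_
  gcongr

lemma contractionFactor_pos {α β γ C ε : ℝ} {d : ℕ} (hn : 3 ≤ n) (hC : 0 < C) (hγ : 0 < γ) :
    0 < contractionFactor n d K α β γ C ε := by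
  have hn3 : (3 : ℝ) ≤ n := by exact_mod_cast hn
  have hw : 0 < √(Real.log n) := Real.sqrt_pos.2 (Real.log_pos (by linarith))
  have : 0 < C / (γ * √(Real.log n)) := by positivity
  exact mul_pos (by norm_num) (this.trans_le (le_max_right _ _))

/-- The radius keeps the first entry of the maximum below $1/4$; the lower bound on `n` does so for
the second. -/
lemma contractionFactor_lt_one {α β γ C ε : ℝ} {d : ℕ} (hn : 3 ≤ n) (hK : 1 ≤ K) (hd : 2 ≤ d)
    (hγ : 0 < γ) (hαβ : β < α) (hexp : Real.exp (16 * C ^ 2 / γ ^ 2) < n)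
    (hε : ε < radius d K α β γ) : contractionFactor n d K α β γ C ε < 1 := by
  have hn3 : (3 : ℝ) ≤ n := by exact_mod_cast hn
  have hw : 0 < √(Real.log n) := Real.sqrt_pos.2 (Real.log_pos (by linarith))
  have hK0 : (0 : ℝ) < K := by exact_mod_cast hK
  have hd1 : (0 : ℝ) < (d : ℝ) - 1 := by
    have : (2 : ℝ) ≤ d := by exact_mod_cast hd
    linarith
  have hab : 0 < α - β := by linarith
  have hκ : 0 < (K : ℝ) ^ ((d : ℝ) - 3 / 2) := Real.rpow_pos_of_pos hK0 _
  have hlt : max (4 * ((d : ℝ) - 1) * ε * (α - β) / (γ * (K : ℝ) ^ ((d : ℝ) - 3 / 2)))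
      (C / (γ * √(Real.log n))) < 1 / 4 := by
    refine max_lt ?_ ?_
    · have h1 := hε.trans_le (min_le_right _ _)
      rw [lt_div_iff₀ (by positivity)] at h1
      rw [div_lt_iff₀ (by positivity)]
      linarith
    · rw [div_lt_iff₀ (by positivity)]
      have h1 : 16 * C ^ 2 / γ ^ 2 < Real.log n := (Real.lt_log_iff_exp_lt (by linarith)).2 hexp
      have h2 : 4 * C / γ < √(Real.log n) := by
        refine Real.lt_sqrt_of_sq_lt (lt_of_eq_of_lt ?_ h1)
        rw [div_pow, mul_pow]
        norm_num
      rw [div_lt_iff₀ hγ] at h2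
      linarith
  rw [contractionFactor]
  linarith

/-! ### Probability of the good event. -/

section Probability

variable {Ω : Type v} [MeasurableSpace Ω] {μ : Measure Ω} [IsProbabilityMeasure μ]
  {p q : unitInterval} {g : Fin n → Fin K} {A : Ω → Tensor (r + 1) n}

lemma IsHSBM.measure_not_isGood_le {α β γ δ : ℝ} (hβ : 0 < β) (hαβ : β < α)
    (hA : IsHSBM μ p q (labelMatrix g) A) (hr : 1 ≤ r) (hK : 1 ≤ K) (hn : 3 ≤ n)
    (hp : (p : ℝ) = α * Real.log n / (n : ℝ) ^ r) (hq : (q : ℝ) = β * Real.log n / (n : ℝ) ^ r)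
    (hqp : (q : ℝ) ≤ p) (hg : labelMatrix g ∈ feasible n K) (hrn : r * K ≤ n)
    (hnα : 1 + (32 + 4 * α + 3 * r * α) / (r * α) ≤ n)
    (hδ : δ = (√α - √β) ^ 2 / ((K : ℝ) ^ r * (r ! : ℝ))
      - γ * Real.log (α / β) / (2 * (r ! : ℝ)) - 1)
    (hnδ : (α - √α * √β) * (r ^ 2 * K) / (r ! * (K : ℝ) ^ r) ≤ δ / 2 * n) :
    μ.real {ω | ¬ IsGood (A ω) p q g α γ} ≤
      K * (n : ℝ) ^ (-(δ / 2)) + (K + 2) * ((r + 1)! : ℝ) / (n : ℝ) ^ 2 := by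
  obtain ⟨m, hmn, -, hm⟩ := exists_community_size hK hg
  have hα : 0 < α := hβ.trans hαβ
  have hn3 : (3 : ℝ) ≤ n := by exact_mod_cast hn
  have hn0 : (0 : ℝ) < n := by linarith
  have hrm : r ≤ m := Nat.le_of_mul_le_mul_right (by rw [hmn]; exact hrn) hK
  set E : Fin n × Fin K → Set Ω := fun x => {ω | x.2 ≠ g x.1 ∧
    tensorApply (A ω) (labelMatrix g) x.1 (g x.1)
        - tensorApply (A ω) (labelMatrix g) x.1 x.2 ≤ γ * Real.log n} with hE
  have hE1 : ∀ x, μ.real (E x) ≤ (n : ℝ) ^ (-(1 + δ / 2)) := by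
    intro x
    by_cases hx : x.2 = g x.1
    · have : E x = ∅ := by
        rw [Set.eq_empty_iff_forall_notMem]
        exact fun ω hω => hω.1 hx
      rw [this, measureReal_empty]
      positivity
    · refine (measureReal_mono fun ω hω => ?_).trans (hA.measure_separation_le_rpow hβ hαβ hr hK hn
        hp hq hmn hrm (hm g hg) x.1 hx hδ hnδ)
      exact hω.2
  have hsub : {ω | ¬ IsGood (A ω) p q g α γ} ⊆
      (⋃ x ∈ (Finset.univ : Finset (Fin n × Fin K)), E x) ∪
      {ω | ∃ (h : Fin n → Fin K) (k : Fin K) (π : Equiv.Perm (Fin (r + 1))),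
        noiseConst r K α * (((Finset.univ.filter fun i => h i ≠ g i).card : ℝ) * Real.log n) <
        ∑ i, noiseSum (A ω) p q g h k π i ^ 2} := by
    intro ω hω
    by_contra hc
    rw [Set.mem_union, not_or] at hc
    refine hω ⟨fun i l hl => ?_, fun h k π => ?_⟩
    · by_contra hlt
      exact hc.1 (Set.mem_biUnion (x := (i, l)) (Finset.mem_coe.2 (Finset.mem_univ _))
        ⟨hl, not_lt.1 hlt⟩)
    · by_contra hlt
      exact hc.2 ⟨h, k, π, not_le.1 hlt⟩
  refine (measureReal_mono hsub).trans ((measureReal_union_le _ _).trans (add_le_add ?_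
    (hA.measure_noise_gt_le hα hr hK hn hnα hp hqp)))
  refine (measureReal_biUnion_finset_le _ _).trans ((Finset.sum_le_sum fun x _ => hE1 x).trans
    (le_of_eq ?_))
  rw [Finset.sum_const, Finset.card_univ, Fintype.card_prod, Fintype.card_fin, Fintype.card_fin,
    nsmul_eq_mul, neg_add, Real.rpow_add hn0, Real.rpow_neg_one]
  push_cast
  field_simp

end Probability

lemma eventually_good_size (r K : ℕ) {δ c M X Y : ℝ} (hδ : 0 < δ) (hc : 0 < c) :
    ∀ᶠ n : ℕ in Filter.atTop, 3 ≤ n ∧ r * K ≤ n ∧ X ≤ n ∧ Y ≤ δ / 2 * n ∧ M ≤ (n : ℝ) ^ c := by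
  have hcast : Filter.Tendsto (fun n : ℕ => (n : ℝ)) Filter.atTop Filter.atTop :=
    tendsto_natCast_atTop_atTop
  refine (Filter.eventually_ge_atTop 3).and ((Filter.eventually_ge_atTop (r * K)).and
    ((hcast.eventually_ge_atTop X).and (((hcast.const_mul_atTop (half_pos hδ)).eventually_ge_atTop
      Y).and (((tendsto_rpow_atTop hc).comp hcast).eventually_ge_atTop M))))

end HSBM

theorem proposition1 (d K : ℕ) (hd : 2 ≤ d) (hK : 2 ≤ K) (α β : ℝ) (hβ : 0 < β) (hαβ : β < α)
    (hthr : (K : ℝ) ^ (d - 1) * ((d - 1)! : ℝ) < (√α - √β) ^ 2) :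
    ∃ C : ℝ, 0 < C ∧
      ∀ γ : ℝ, 0 < γ →
        0 < (√α - √β) ^ 2 / ((K : ℝ) ^ (d - 1) * ((d - 1)! : ℝ))
          - γ * Real.log (α / β) / (2 * ((d - 1)! : ℝ)) - 1 →
        ∃ c : ℝ, 0 < c ∧ ∃ N : ℕ, ∀ n : ℕ, N ≤ n → Real.exp (16 * C ^ 2 / γ ^ 2) < (n : ℝ) →
          ∀ p q : unitInterval,
            (p : ℝ) = α * Real.log n / (n : ℝ) ^ (d - 1) →
            (q : ℝ) = β * Real.log n / (n : ℝ) ^ (d - 1) →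
          ∀ Hs ∈ HSBM.feasible n K,
          ∀ (Ω : Type u) [MeasurableSpace Ω] (μ : Measure Ω) [IsProbabilityMeasure μ]
            (A : Ω → HSBM.Tensor d n), HSBM.IsHSBM μ p q Hs A →
          1 - (n : ℝ) ^ (-c) ≤ μ.real {ω |
            (∀ (i : Fin n) (k l : Fin K), Hs i k = 1 → k ≠ l →
              γ * Real.log n ≤
                HSBM.tensorApply (A ω) Hs i k - HSBM.tensorApply (A ω) Hs i l) ∧
            ∀ ε : ℝ, 0 < ε → ε < HSBM.radius d K α β γ →
              0 < HSBM.contractionFactor n d K α β γ C ε ∧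
              HSBM.contractionFactor n d K α β γ C ε < 1 ∧
              ∀ H ∈ HSBM.feasible n K, ∀ σ : Equiv.Perm (Fin K),
                ‖H - Hs * σ.permMatrix ℝ‖ ≤ ε * √(n : ℝ) →
                ∀ V ∈ HSBM.proj (HSBM.tensorApply (A ω) H),
                  ‖V - Hs * σ.permMatrix ℝ‖ ≤
                    HSBM.contractionFactor n d K α β γ C ε * ‖H - Hs * σ.permMatrix ℝ‖} := by
  obtain ⟨r, rfl⟩ : ∃ r, d = r + 1 := ⟨d - 1, by omega⟩
  have hr : 1 ≤ r := by omega
  have hK1 : 1 ≤ K := by omega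
  have hα : 0 < α := hβ.trans hαβ
  have hr0 : (0 : ℝ) < r := by exact_mod_cast hr
  simp only [Nat.add_sub_cancel]
  have hC : 0 < HSBM.contractionConst r K α β := by
    have := HSBM.noiseConst_pos hα r K
    unfold HSBM.contractionConst
    positivity
  refine ⟨HSBM.contractionConst r K α β, hC, fun γ hγ hδ0 => ?_⟩
  set δ := (√α - √β) ^ 2 / ((K : ℝ) ^ r * (r ! : ℝ))
      - γ * Real.log (α / β) / (2 * (r ! : ℝ)) - 1 with hδ
  -- Every bad event has probability of order $n^{-2c}$, since $2c\le\delta/2$ and $2c\le2$. One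
  -- factor $n^{-c}$ then absorbs `M`, which includes the $K!$ relabellings.
  set c := min (δ / 4) 1 with hc
  have hc0 : 0 < c := lt_min (by linarith) one_pos
  set M : ℝ := K ! * (K + (K + 2) * ((r + 1)! : ℝ)) with hM
  have hM0 : 0 ≤ M := by positivity
  obtain ⟨N, hN⟩ := Filter.eventually_atTop.1 (HSBM.eventually_good_size r K (δ := δ) (c := c)
    (M := M) (X := 1 + (32 + 4 * α + 3 * r * α) / (r * α))
    (Y := (α - √α * √β) * (r ^ 2 * K) / (r ! * (K : ℝ) ^ r)) hδ0 hc0)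
  refine ⟨c, hc0, N, fun n hnN hexp p q hp hq Hs hHs Ω _ μ _ A hA => ?_⟩
  obtain ⟨hn, hrn, hnα, hnδ, hnM⟩ := hN n hnN
  obtain ⟨g, rfl⟩ := HSBM.exists_labelMatrix hHs
  have hn3 : (3 : ℝ) ≤ n := by exact_mod_cast hn
  have hn0 : (0 : ℝ) < n := by linarith
  have hn1 : (1 : ℝ) ≤ n := by linarith
  have hlog : 0 < Real.log n := Real.log_pos (by linarith)
  have hqp : (q : ℝ) ≤ p := by
    rw [hp, hq]
    gcongr
  set bad : Equiv.Perm (Fin K) → Set Ω := fun σ =>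
    {ω | ¬ HSBM.IsGood (A ω) p q (σ ∘ g) α γ} with hbad
  have hbad1 : ∀ σ, μ.real (bad σ) ≤ (K + (K + 2) * ((r + 1)! : ℝ)) * (n : ℝ) ^ (-(2 * c)) := by
    intro σ
    refine ((hA.perm σ).measure_not_isGood_le hβ hαβ hr hK1 hn hp hq hqp
      (HSBM.labelMatrix_perm_mem_feasible hHs σ) hrn hnα hδ hnδ).trans ?_
    have h1 : (n : ℝ) ^ (-(δ / 2)) ≤ (n : ℝ) ^ (-(2 * c)) := by
      refine Real.rpow_le_rpow_of_exponent_le hn1 ?_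
      linarith [min_le_left (δ / 4) 1]
    have h2 : 1 / (n : ℝ) ^ 2 ≤ (n : ℝ) ^ (-(2 * c)) := by
      have h3 : 1 / (n : ℝ) ^ 2 = (n : ℝ) ^ (-2 : ℝ) := by
        rw [Real.rpow_neg hn0.le, one_div]
        norm_cast
      rw [h3]
      refine Real.rpow_le_rpow_of_exponent_le hn1 ?_
      linarith [min_le_right (δ / 4) 1]
    rw [add_mul (K : ℝ) (_ * _), ← mul_one_div (_ * _) ((n : ℝ) ^ 2)]
    exact add_le_add (mul_le_mul_of_nonneg_left h1 (by positivity))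
      (mul_le_mul_of_nonneg_left h2 (by positivity))
  have hU : μ.real (⋃ σ ∈ (Finset.univ : Finset (Equiv.Perm (Fin K))), bad σ) ≤ (n : ℝ) ^ (-c) := by
    refine (measureReal_biUnion_finset_le _ _).trans
      ((Finset.sum_le_sum fun σ _ => hbad1 σ).trans ?_)
    rw [Finset.sum_const, Finset.card_univ, Fintype.card_perm, Fintype.card_fin, nsmul_eq_mul,
      ← mul_assoc, ← hM]
    have h1 : (n : ℝ) ^ (-(2 * c)) = (n : ℝ) ^ (-c) * (n : ℝ) ^ (-c) := by
      rw [← Real.rpow_add hn0]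
      ring_nf
    have h2 : (n : ℝ) ^ c * (n : ℝ) ^ (-c) = 1 := by
      rw [← Real.rpow_add hn0]
      simp
    have h3 : 0 ≤ (n : ℝ) ^ (-c) := by positivity
    calc M * (n : ℝ) ^ (-(2 * c)) ≤ (n : ℝ) ^ c * (n : ℝ) ^ (-(2 * c)) := by gcongr
      _ = (n : ℝ) ^ (-c) := by rw [h1, ← mul_assoc, h2, one_mul]
  set good := {ω | _} with hgood
  -- Covering the space and using subadditivity avoids measurability of the good set.
  have hcover : (Set.univ : Set Ω) ⊆
      good ∪ ⋃ σ ∈ (Finset.univ : Finset (Equiv.Perm (Fin K))), bad σ := by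
    intro ω _
    by_contra hω
    rw [Set.mem_union, not_or] at hω
    have hall : ∀ σ : Equiv.Perm (Fin K), HSBM.IsGood (A ω) p q (σ ∘ g) α γ := by
      intro σ
      by_contra hσ
      exact hω.2 (Set.mem_biUnion (x := σ) (Finset.mem_coe.2 (Finset.mem_univ _)) hσ)
    refine hω.1 ⟨fun i k l hik hkl => ?_, fun ε hε hεr =>
      ⟨HSBM.contractionFactor_pos hn hC hγ,
        HSBM.contractionFactor_lt_one hn hK1 hd hγ hαβ hexp hεr, fun H hH σ hHσ V hV => ?_⟩⟩
    · have hgi : g i = k := by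
        by_contra hne
        simp [hne] at hik
      subst hgi
      exact ((hall 1).1 i l hkl.symm).le
    · rw [HSBM.labelMatrix_mul_permMatrix] at hHσ ⊢
      exact (hall σ).contraction (hA.symmetric ω) (hA.diagonal ω) hr hK1 hn hβ hαβ hγ hp hq hqp
        (HSBM.labelMatrix_perm_mem_feasible hHs σ) hε hH hHσ hV
  have hone : 1 ≤ μ.real good +
      μ.real (⋃ σ ∈ (Finset.univ : Finset (Equiv.Perm (Fin K))), bad σ) := by
    rw [← probReal_univ (μ := μ)]
    exact (measureReal_mono hcover).trans (measureReal_union_le _ _)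
  linarith
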